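/- **Setting.** Let $w(x)=(1-x^2)^{-1/2}$ on $(-1,1)$, let $(u,v)=\int_{-1}^1 uv\,w\,dx$ and $\|v\|=(v,v)^{1/2}$ be the inner product and norm of $L^2_w=L^2((-1,1),w\,dx)$, and let $R_n$ be the $(\cdot,\cdot)$-orthogonal projection onto the space $\mathbb P^n$ of polynomials of degree at most $n$ (the truncated Chebyshev series). For an integer $k\ge 0$ put $$\|v\|_{k}=\Big(\|v\|^2+\sum_{j=1}^{k}\int_{-1}^1|\partial_x^jv|^2dx\Big)^{1/2},$$ so that $\|v\|_0=\|v\|$. Let $p\in\{0,1,2\}$ and consider on $[-1,1]$ the scalar equation $$u_t=A_0u+A_1u_x+A_2u_{xx}+f,$$ in which only the terms of order at most $p$ are present, $A_0,A_1,A_2$ being bounded and measurable, with the $p$ boundary conditions $Bu_{bf}(t)=h(t)$, where $B\in\mathbb R^{p\times 2p}$ and $u_{bf}$ is empty for $p=0$, $(u(-1),u(1))$ for $p=1$, and $(u(-1),u(1),u_x(-1),u_x(1))$ for $p=2$. Let $K(x)$ be empty, $[1]$, $[1\;\;x+1]$ for $p=0,1,2$ respectively, let $V=\partial_xK$, let $T$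 be the $2p\times p$ matrix with $T=(1,1)^{\mathsf T}$ for $p=1$ and rows $(1,0),(1,2),(0,1),(0,1)$ for $p=2$, and let $Q(s)=(0,1)^{\mathsf T}$ for $p=1$ and $Q(s)=(0,1-s,0,1)^{\mathsf T}$ for $p=2$. Assume that $B_T=BT$ is invertible. Put $\mathcal Tv=v$ if $p=0$, and otherwise $$(\mathcal Tv)(x)=\int_{-1}^x(x-s)^{p-1}v(s)\,ds-\int_{-1}^1K(x)B_T^{-1}BQ(s)v(s)\,ds .$$ Let $\mathcal A$ be the integral operator $\mathcal A=A_0\mathcal T+A_1\partial_x\mathcal T+A_2\partial_x^2\mathcal T$ (only the terms of order at most $p$), written with its explicit kernels. The primary state with fundamental state $u_f$ is $u^h=KB_T^{-1}h+\mathcal Tu_f$, and $$g=A_0KB_T^{-1}h+A_1VB_T^{-1}h-KB_T^{-1}\dot h+f .$$ Let $u_f:[0,\infty)\to L^2_w$ be differentiable (as is $h$) and satisfy $\mathcal T\dot u_f=\mathcal Au_f+g$ for all $t\ge0$. Let $m\ge p$ be an integer such that $u^h(t)$ and $\partial_tu^h(t)=KB_T^{-1}\dot h(t)+\mathcal T\dot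 u_f(t)$ have $m$ square-integrable weak spatial derivatives for all $t\ge0$, and such that $\|u_f(t)\|_{m-p}$, $\|\dot u_f(t)\|_{m-p}$ and $\|g(t)\|$ are locally square integrable in $t$ (note that $u_f=\partial_x^pu^h$). For an integer $N>p$, a Galerkin solution is a function $\hat u_f(t)\in\mathbb P^{N-p}$, with coefficients differentiable in $t\ge0$, such that $\hat u_f(0)=R_{N-p}u_f(0)$ and $$(\mathcal T\partial_t\hat u_f,v)=(\mathcal A\hat u_f+R_{N-p}g,v)\qquad\text{for all }v\in\mathbb P^{N-p},\ t\ge0 .$$ Put $\hat u^h=KB_T^{-1}h+\mathcal T\hat u_f$ and $\widehat{\hat u^h}=R_{N-p}\hat u^h$. **Theorem.** Assume the discrete non-positivity property $$(R_n\mathcal Aq,\,R_n\mathcal Tq)\le0\qquad\text{for all }n>0\text{ and all }q\in\mathbb P^n .$$ 1. There is a constant $C$ that depends only on $p$, $m$, $A_0,A_1,A_2$ and $B$ (not on $N$, $t$, $h$, $f$, $u_f$ or $\hat u_f$) such that for all $N>p$ and all $t\ge0$ $$\|u^h(t)-\widehat{\hat u^h(t)}\|\le C(N-p)^{p-m}\Big\{\|u_f(t)\|_{m-p}+e^{t/2}\Big(\int_0^t\big(\|\dot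 u_f(s)\|_{m-p}^2+\|u_f(s)\|_{m-p}^2+\|g(s)\|^2\big)ds\Big)^{1/2}\Big\}.$$ 2. For every such solution $u_f$ and every $t\ge0$ there is a constant $C$, independent of $N$ (and of the Galerkin solution), such that for all $N>p$ $$\|u^h(t)-\widehat{\hat u^h(t)}\|\le C(N-p)^{p-m}\Big\{\|u_f(t)\|+e^{t/2}\Big(\int_0^t\big(\|\dot u_f(s)\|^2+\|u_f(s)\|^2+\|g(s)\|^2\big)ds\Big)^{1/2}\Big\}.$$ -/

import Mathlib

open MeasureTheory Set
open Polynomial.Chebyshev (measureT)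
open scoped Matrix

noncomputable section

namespace PIE

/-! ### The Chebyshev-weighted Hilbert space on `[-1, 1]`

`measureT` is Mathlib's measure `w(x) dx` on `(-1, 1]` with `w(x) = 1 / √(1 - x ^ 2)`. -/

/-- The weighted inner product `(u, v) = ∫_{-1}^{1} u v w dx`. -/
def chebInner (u v : ℝ → ℝ) : ℝ := ∫ x, u x * v x ∂measureT

/-- The norm `‖v‖ = (v, v)^{1/2}`. -/
def chebNorm (v : ℝ → ℝ) : ℝ := √(chebInner v v)

/-- The Chebyshev polynomial `T_k` of the first kind, as a function. -/
def chebT (k : ℕ) : ℝ → ℝ := fun x => (Polynomial.Chebyshev.T ℝ k).eval x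

/-- The polynomial `∑_{k ≤ n} a_k T_k`. -/
def chebSum (n : ℕ) (a : ℕ → ℝ) : ℝ → ℝ :=
  fun x => ∑ k ∈ Finset.range (n + 1), a k * chebT k x

/-- The `k`-th Chebyshev coefficient of `v`. -/
def chebCoeff (v : ℝ → ℝ) (k : ℕ) : ℝ := chebInner v (chebT k) / chebInner (chebT k) (chebT k)

/-- The orthogonal projection `R_n` onto the polynomials of degree at most `n`, i.e. the truncated
Chebyshev series. -/
def chebProj (n : ℕ) (v : ℝ → ℝ) : ℝ → ℝ := chebSum n (chebCoeff v)

/-! ### Sobolev spaces on `[-1, 1]` -/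

/-- `v'` is the weak derivative of `v` on `(-1, 1)`: `v'` is integrable and `v` agrees almost
everywhere with a primitive of `v'`. -/
def HasWeakDeriv (v v' : ℝ → ℝ) : Prop :=
  IntervalIntegrable v' volume (-1) 1 ∧
    ∃ c : ℝ, ∀ᵐ x ∂(volume.restrict (Icc (-1 : ℝ) 1)), v x = c + ∫ s in (-1)..x, v' s

/-- `v ∈ H_k[-1, 1]`: the weak derivatives of orders `0, …, k` exist and are square integrable. -/
def MemH : ℕ → (ℝ → ℝ) → Prop
  | 0, v => MemLp v 2 (volume.restrict (Icc (-1 : ℝ) 1))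
  | k + 1, v => MemLp v 2 (volume.restrict (Icc (-1 : ℝ) 1)) ∧
      ∃ v', HasWeakDeriv v v' ∧ MemH k v'

open Classical in
/-- The weak derivative of `v` (unique up to a null subset of `[-1, 1]`) if there is one. -/
def weakDeriv (v : ℝ → ℝ) : ℝ → ℝ :=
  if hv : ∃ v', HasWeakDeriv v v' then hv.choose else 0

/-- The square of the Sobolev norm of order `k`:
`‖v‖² + ∑_{1 ≤ j ≤ k} ∫_{-1}^{1} |∂_x^j v|² dx`. The weight `w` occurs only in the term of order
zero; as `w ≥ 1`, this is at most the square of the fully weighted norm. -/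
def sobolevSq (k : ℕ) (v : ℝ → ℝ) : ℝ :=
  chebInner v v + ∑ j ∈ Finset.Icc 1 k, ∫ x in (-1)..1, (weakDeriv^[j] v x) ^ 2

/-- The Sobolev norm of order `k`. -/
def sobolevNorm (k : ℕ) (v : ℝ → ℝ) : ℝ := √(sobolevSq k v)

/-! ### The scalar PDE and its partial-integral operators

The minimum smoothness `p ∈ {0, 1, 2}` is the number of spatial derivatives in the equation. For
`a = -1`, `b = 1` the scalar case has exactly one of `n_0, n_1, n_2` equal to one, namely `n_p`. -/

/-- The data of a scalar equation
`u_t = A_0 u + A_1 u_x + A_2 u_{xx} + f` on `[-1, 1]`, in which only the terms of order at most `p`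
are present, with `p` boundary conditions `B u_{bf} = h(t)`, where `u_{bf}` is
empty for `p = 0`, `(u(-1), u(1))` for `p = 1`, and `(u(-1), u(1), u_x(-1), u_x(1))` for `p = 2`. -/
structure ScalarPDE (p : ℕ) where
  A₀ : ℝ → ℝ
  A₁ : ℝ → ℝ
  A₂ : ℝ → ℝ
  B : Matrix (Fin p) (Fin (2 * p)) ℝ

/-- The matrix that sends the core boundary values (`u(-1)`, respectively `(u(-1), u_x(-1))`) to the
contribution they make to `u_{bf}`. -/
def bdryT : (p : ℕ) → Matrix (Fin (2 * p)) (Fin p) ℝ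
  | 1 => !![1; 1]
  | 2 => !![1, 0; 1, 2; 0, 1; 0, 1]
  | _ => 0

/-- The kernel that gives the contribution of the fundamental state to `u_{bf}`. -/
def bdryQ : (p : ℕ) → ℝ → Fin (2 * p) → ℝ
  | 1, _ => ![0, 1]
  | 2, s => ![0, 1 - s, 0, 1]
  | _, _ => 0

/-- The row `K(x)`: empty for `p = 0`, `[1]` for `p = 1` and `[1, x + 1]` for `p = 2`. -/
def rowK (p : ℕ) (x : ℝ) : Fin p → ℝ := fun j => (x + 1) ^ (j : ℕ)

/-- The row `V = ∂_x K`: empty for `p = 0`, `[0]` for `p = 1` and `[0, 1]` for `p = 2`. -/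
def rowV (p : ℕ) : Fin p → ℝ := fun j => if (j : ℕ) = 1 then 1 else 0

/-- The 3-PI operator with parameters `N₀`, `N₁`, `N₂`. -/
def threePI (N₀ : ℝ → ℝ) (N₁ N₂ : ℝ → ℝ → ℝ) (v : ℝ → ℝ) : ℝ → ℝ := fun x =>
  N₀ x * v x + (∫ s in (-1)..x, N₁ x s * v s) + ∫ s in (-1)..1, N₂ x s * v s

def kerG₀ (p : ℕ) : ℝ := if p = 0 then 1 else 0

def kerG₁ (p : ℕ) (x s : ℝ) : ℝ := if p = 1 then 1 else if p = 2 then x - s else 0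

def kerG₃ (p : ℕ) : ℝ := if p = 1 then 1 else 0

def kerG₄ (p : ℕ) : ℝ := if p = 2 then 1 else 0

namespace ScalarPDE

variable {p : ℕ} (P : ScalarPDE p)

/-- The matrix `B_T = B T`. -/
def BT : Matrix (Fin p) (Fin p) ℝ := P.B * bdryT p

/-- The coefficients are bounded measurable functions on `[-1, 1]`, and `B_T` is invertible. -/
structure Admissible : Prop where
  meas₀ : Measurable P.A₀
  meas₁ : Measurable P.A₁
  meas₂ : Measurable P.A₂
  bdd₀ : ∃ M : ℝ, ∀ x ∈ Icc (-1 : ℝ) 1, |P.A₀ x| ≤ M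
  bdd₁ : ∃ M : ℝ, ∀ x ∈ Icc (-1 : ℝ) 1, |P.A₁ x| ≤ M
  bdd₂ : ∃ M : ℝ, ∀ x ∈ Icc (-1 : ℝ) 1, |P.A₂ x| ≤ M
  inv : IsUnit P.BT

def kerG₂ (x s : ℝ) : ℝ := -(rowK p x ⬝ᵥ ((P.BT⁻¹ * P.B) *ᵥ bdryQ p s))

def kerG₅ (s : ℝ) : ℝ := -(rowV p ⬝ᵥ ((P.BT⁻¹ * P.B) *ᵥ bdryQ p s))

/-- The operator `𝒯`, which recovers the primary state from the fundamental state under homogeneous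
boundary conditions. -/
def opT : (ℝ → ℝ) → ℝ → ℝ := threePI (fun _ => kerG₀ p) (kerG₁ p) P.kerG₂

/-- The operator `𝒜 = A_0 𝒯 + A_1 ∂_x 𝒯 + A_2 ∂_x^2 𝒯`, in 3-PI form. -/
def opA : (ℝ → ℝ) → ℝ → ℝ :=
  threePI
    (fun x => P.A₀ x * kerG₀ p + P.A₁ x * kerG₃ p + if p = 2 then P.A₂ x else 0)
    (fun x s => P.A₀ x * kerG₁ p x s + P.A₁ x * kerG₄ p)
    (fun x s => P.A₀ x * P.kerG₂ x s + P.A₁ x * P.kerG₅ s)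

/-- The primary state `u^h = K B_T⁻¹ h + 𝒯 u_f` with boundary data `h` and fundamental state `v`. -/
def primary (h : Fin p → ℝ) (v : ℝ → ℝ) : ℝ → ℝ := fun x =>
  rowK p x ⬝ᵥ (P.BT⁻¹ *ᵥ h) + P.opT v x

/-- The lumped source `g = A_0 K B_T⁻¹ h + A_1 V B_T⁻¹ h - K B_T⁻¹ ḣ + f` at a fixed time; `h'`
stands for `ḣ`. -/
def lumped (h h' : Fin p → ℝ) (f : ℝ → ℝ) : ℝ → ℝ := fun x =>
  P.A₀ x * (rowK p x ⬝ᵥ (P.BT⁻¹ *ᵥ h)) + P.A₁ x * (rowV p ⬝ᵥ (P.BT⁻¹ *ᵥ h))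
    - rowK p x ⬝ᵥ (P.BT⁻¹ *ᵥ h') + f x

/-- The discrete non-positivity `(𝒜 q, 𝒯 q)_n = (R_n 𝒜 q, R_n 𝒯 q) ≤ 0` for all `n > 0` and all
polynomials `q` of degree at most `n`. -/
def DiscreteNonpos : Prop :=
  ∀ n : ℕ, 0 < n → ∀ q : Polynomial ℝ, q.natDegree ≤ n →
    chebInner (chebProj n (P.opA fun x => q.eval x)) (chebProj n (P.opT fun x => q.eval x)) ≤ 0

/-- `u_f` solves the partial integral equation `𝒯 u̇_f = 𝒜 u_f + g` for `t ≥ 0`, with boundary data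
`h` and forcing `f`. Time derivatives (`uf'`, `h'`) are taken in the weighted `L_2`-space and in
`ℝ^p`. -/
structure IsPIESolution (h h' : ℝ → Fin p → ℝ) (f : ℝ → ℝ → ℝ)
    (uf uf' : ℝ → Lp ℝ 2 measureT) : Prop where
  deriv_h : ∀ t, 0 ≤ t → HasDerivWithinAt h (h' t) (Ici 0) t
  deriv_uf : ∀ t, 0 ≤ t → HasDerivWithinAt uf (uf' t) (Ici 0) t
  eqn : ∀ t, 0 ≤ t → ∀ᵐ x ∂measureT,
    P.opT (uf' t) x = P.opA (uf t) x + P.lumped (h t) (h' t) (f t) x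

/-- The primary state and its time derivative `K B_T⁻¹ ḣ + 𝒯 u̇_f` have `m` square-integrable spatial
derivatives, and the norms of `u_f`, `u̇_f` (of the corresponding order `m - p`, because
`u_f = ∂_x^p u^h`) and of `g` are locally square integrable in time. -/
structure HasRegularity (m : ℕ) (h h' : ℝ → Fin p → ℝ) (f : ℝ → ℝ → ℝ)
    (uf uf' : ℝ → Lp ℝ 2 measureT) : Prop where
  memH : ∀ t, 0 ≤ t → MemH m (P.primary (h t) (uf t))
  memH_deriv : ∀ t, 0 ≤ t → MemH m (P.primary (h' t) (uf' t))
  int_uf : ∀ t, 0 ≤ t → IntervalIntegrable (fun s => sobolevSq (m - p) (uf s)) volume 0 t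
  int_uf' : ∀ t, 0 ≤ t → IntervalIntegrable (fun s => sobolevSq (m - p) (uf' s)) volume 0 t
  int_g : ∀ t, 0 ≤ t →
    IntervalIntegrable (fun s => chebNorm (P.lumped (h s) (h' s) (f s)) ^ 2) volume 0 t

/-- `û_f = ∑_{k ≤ n} a_k(t) T_k` is the Galerkin solution in the polynomials of degree at most `n`
(for `n = N - p`): the residual of the partial integral equation with source `ĝ = R_n g` is
orthogonal to all polynomials of degree at most `n`, and `û_f(0) = R_n u_f(0)`. -/
structure IsGalerkinSolution (n : ℕ) (h h' : ℝ → Fin p → ℝ) (f : ℝ → ℝ → ℝ)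
    (uf0 : ℝ → ℝ) (a a' : ℝ → ℕ → ℝ) : Prop where
  deriv : ∀ k ≤ n, ∀ t, 0 ≤ t → HasDerivWithinAt (fun s => a s k) (a' t k) (Ici 0) t
  weak : ∀ t, 0 ≤ t → ∀ q : Polynomial ℝ, q.natDegree ≤ n →
    chebInner (P.opT (chebSum n (a' t))) (fun x => q.eval x) =
      chebInner (fun x => P.opA (chebSum n (a t)) x +
        chebProj n (P.lumped (h t) (h' t) (f t)) x) (fun x => q.eval x)
  init : ∀ k ≤ n, a 0 k = chebCoeff uf0 k

/-- The error `‖u^h - R_n û^h‖` with `û^h = K B_T⁻¹ h + 𝒯 û_f` and `û_f = ∑_{k ≤ n} a_k T_k`, at a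
fixed time. -/
def primaryError (n : ℕ) (h : Fin p → ℝ) (v : ℝ → ℝ) (a : ℕ → ℝ) : ℝ :=
  chebNorm fun x => P.primary h v x - chebProj n (P.primary h (chebSum n a)) x

end ScalarPDE

end PIE

end

/-! Write `n = N - p`, `k = m - p`, and let `R` be the orthogonal projection of `L²_w` onto
polynomials of degree at most `n`. As elements of `L²_w`, `𝒯` and `𝒜` are bounded operators, and the
argument is an energy estimate for a Galerkin scheme.

The polynomial `K B_T⁻¹ h` is fixed by `R` and cancels, so the error is `𝒯 u_f - R 𝒯 û_f`, which
splits into `(𝒯 u_f - R 𝒯 u_f) + R 𝒯 (u_f - R u_f) + e` with `e = R 𝒯 (R u_f - û_f)`. Subtracting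
the Galerkin equation from the projected one gives `ė = R 𝒜 (R u_f - û_f) + r`, where `r` contains
only the projection errors of `u_f` and `u̇_f`. Discrete non-positivity for `q = R u_f - û_f` yields
`(ė, e) ≤ (r, e)`, and since `e(0) = 0`, Grönwall (`norm_sq_le_exp_mul_integral`) bounds `e` by `r`.
This is assembled in `ScalarPDE.exists_primaryError_le`.

The rate is `‖v - R v‖ ≤ C n^{-k} ‖v‖_k` (`norm_sub_starProjection_le_sobolevNorm`). The `i`-th
derivatives of the `T_j` are orthogonal for the weight `(1 - x²)^i w`, with square norms multiplied
by `∏_{l < i} (j² - l²)`; Bessel's inequality for `∂_x^k v` in this weight controls the high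
coefficients. The first term of the splitting has the same rate because `𝒯` raises polynomial degree
by at most `p`.

Part 2 follows from part 1 by rescaling the constant by the ratio of the two brackets. When the
denominator vanishes, the estimate with `k = 0` shows that the error is zero. -/

namespace PIE

/-! ### The Chebyshev weight against Lebesgue measure -/

/-- The density is strictly positive on the open interval and the endpoints are null, so both
measures have the same null sets. -/
theorem ae_measureT_iff {q : ℝ → Prop} :
    (∀ᵐ x ∂measureT, q x) ↔ ∀ᵐ x ∂(volume.restrict (Icc (-1 : ℝ) 1)), q x := by
  rw [← restrict_Ioo_eq_restrict_Icc, measureT, restrict_withDensity (by measurability),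
    ← restrict_Ioo_eq_restrict_Ioc, ae_withDensity_iff (by fun_prop)]
  rw [ae_restrict_iff' measurableSet_Ioo, ae_restrict_iff' measurableSet_Ioo]
  refine Filter.eventually_congr (Filter.Eventually.of_forall fun x => ?_)
  refine forall_congr' fun hx => ?_
  have h1 : (0 : ℝ) < 1 - x ^ 2 := by nlinarith [hx.1, hx.2]
  have h2 : 0 < √(1 - x ^ 2)⁻¹ := Real.sqrt_pos.2 (inv_pos.2 h1)
  refine ⟨fun h => h ?_, fun h _ => h⟩
  simp only [ne_eq, ENNReal.coe_eq_zero]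
  intro h0
  exact h2.ne' (congrArg NNReal.toReal h0)

/-- This is `w ≥ 1`; it makes every element of `L²_w` square integrable without weight. -/
theorem restrict_Icc_le_measureT : volume.restrict (Icc (-1 : ℝ) 1) ≤ measureT := by
  rw [← restrict_Ioo_eq_restrict_Icc, measureT, restrict_withDensity (by measurability),
    ← restrict_Ioo_eq_restrict_Ioc]
  conv_lhs => rw [← withDensity_one (μ := volume.restrict (Ioo (-1 : ℝ) 1))]
  refine withDensity_mono ?_
  filter_upwards [ae_restrict_mem measurableSet_Ioo] with x hx
  have h1 : (0 : ℝ) < 1 - x ^ 2 := by nlinarith [hx.1, hx.2]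
  have h2 : 1 ≤ √(1 - x ^ 2)⁻¹ :=
    Real.one_le_sqrt.2 ((one_le_inv₀ h1).2 (by nlinarith [sq_nonneg x]))
  simp only [Pi.one_apply, ENNReal.one_le_coe_iff]
  exact h2

instance : IsFiniteMeasure measureT := by
  have h : Integrable (fun _ : ℝ => (1 : ℝ)) measureT :=
    Polynomial.Chebyshev.integrable_measureT continuousOn_const
  exact (integrable_const_iff.1 h).resolve_left one_ne_zero

theorem ae_measureT_mem_Icc : ∀ᵐ x ∂measureT, x ∈ Icc (-1 : ℝ) 1 :=
  ae_measureT_iff.2 (ae_restrict_mem measurableSet_Icc)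

theorem memLp_measureT_of_bound {f : ℝ → ℝ} (hf : AEStronglyMeasurable f measureT) (M : ℝ)
    (hM : ∀ x ∈ Icc (-1 : ℝ) 1, |f x| ≤ M) : MemLp f 2 measureT :=
  MemLp.of_bound hf M (ae_measureT_mem_Icc.mono fun x hx => hM x hx)

theorem aestronglyMeasurable_measureT {f : ℝ → ℝ}
    (hf : AEStronglyMeasurable f (volume.restrict (Icc (-1 : ℝ) 1))) :
    AEStronglyMeasurable f measureT := by
  obtain ⟨g, hg, hfg⟩ := hf
  exact ⟨g, hg, ae_measureT_iff.2 hfg⟩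

theorem memLp_measureT_of_continuousOn {f : ℝ → ℝ} (hf : ContinuousOn f (Icc (-1) 1)) :
    MemLp f 2 measureT := by
  obtain ⟨M, hM⟩ := isCompact_Icc.exists_bound_of_continuousOn hf
  exact memLp_measureT_of_bound
    (aestronglyMeasurable_measureT (hf.aestronglyMeasurable measurableSet_Icc)) M hM

theorem memLp_restrict_of_memLp_measureT {f : ℝ → ℝ} (hf : MemLp f 2 measureT) :
    MemLp f 2 (volume.restrict (Icc (-1 : ℝ) 1)) :=
  hf.mono_measure restrict_Icc_le_measureT

theorem intervalIntegrable_of_memLp {f : ℝ → ℝ}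
    (hf : MemLp f 2 (volume.restrict (Icc (-1 : ℝ) 1))) :
    IntervalIntegrable f volume (-1) 1 := by
  rw [intervalIntegrable_iff_integrableOn_Icc_of_le (by norm_num)]
  exact hf.integrable one_le_two

theorem integral_one_sub_sq_pow_mul_measureT (i : ℕ) (f : ℝ → ℝ) :
    ∫ x, (1 - x ^ 2) ^ (i + 1) * f x ∂measureT =
      ∫ x in (-1)..1, (1 - x ^ 2) ^ i * √(1 - x ^ 2) * f x := by
  rw [Polynomial.Chebyshev.integral_measureT]
  refine intervalIntegral.integral_congr fun x hx => ?_
  rw [uIcc_of_le (by norm_num)] at hx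
  have h : (0 : ℝ) ≤ 1 - x ^ 2 := by nlinarith [hx.1, hx.2]
  -- At the endpoints this reads `0 = 0`, because `0⁻¹ = 0`.
  have h2 : (1 - x ^ 2) * √(1 - x ^ 2)⁻¹ = √(1 - x ^ 2) := by
    rw [Real.sqrt_inv, ← div_eq_mul_inv, Real.div_sqrt]
  calc (1 - x ^ 2) ^ (i + 1) * f x * √(1 - x ^ 2)⁻¹
      = (1 - x ^ 2) ^ i * ((1 - x ^ 2) * √(1 - x ^ 2)⁻¹) * f x := by ring
    _ = _ := by rw [h2]

theorem integrable_one_sub_sq_pow_mul_measureT (i : ℕ) {f : ℝ → ℝ}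
    (hf : IntervalIntegrable f volume (-1) 1) :
    Integrable (fun x => (1 - x ^ 2) ^ (i + 1) * f x) measureT := by
  have h0 : IntervalIntegrable (fun x => (1 - x ^ 2) ^ i * √(1 - x ^ 2) * f x) volume (-1) 1 :=
    hf.continuousOn_mul (by fun_prop)
  rw [intervalIntegrable_iff, uIoc_of_le (by norm_num)] at h0
  rw [measureT, restrict_withDensity (by measurability),
    integrable_withDensity_iff (by fun_prop) (by simp)]
  refine Integrable.congr h0 ?_
  filter_upwards [ae_restrict_mem measurableSet_Ioc] with x hx
  have h : (0 : ℝ) ≤ 1 - x ^ 2 := by nlinarith [hx.1, hx.2]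
  have h2 : (1 - x ^ 2) * √(1 - x ^ 2)⁻¹ = √(1 - x ^ 2) := by
    rw [Real.sqrt_inv, ← div_eq_mul_inv, Real.div_sqrt]
  change (1 - x ^ 2) ^ i * √(1 - x ^ 2) * f x = (1 - x ^ 2) ^ (i + 1) * f x * √(1 - x ^ 2)⁻¹
  rw [← h2]; ring

/-! ### Weak derivatives and Sobolev membership -/

theorem HasWeakDeriv.congr {v w v' w' : ℝ → ℝ} (h : HasWeakDeriv v v')
    (hv : ∀ᵐ x ∂(volume.restrict (Icc (-1 : ℝ) 1)), v x = w x)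
    (hv' : ∀ᵐ x ∂(volume.restrict (Icc (-1 : ℝ) 1)), v' x = w' x) : HasWeakDeriv w w' := by
  obtain ⟨hi, c, hc⟩ := h
  have hv'2 : ∀ᵐ x ∂volume, x ∈ Icc (-1 : ℝ) 1 → v' x = w' x :=
    (ae_restrict_iff' measurableSet_Icc).1 hv'
  refine ⟨hi.congr_ae ?_, c, ?_⟩
  · rw [uIoc_of_le (by norm_num)]
    exact ae_restrict_of_ae_restrict_of_subset Ioc_subset_Icc_self hv'
  · filter_upwards [hc, hv, ae_restrict_mem measurableSet_Icc] with x hx hx2 hx3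
    rw [← hx2, hx]
    congr 1
    refine intervalIntegral.integral_congr_ae ?_
    filter_upwards [hv'2] with s hs hs2
    rw [uIoc_of_le hx3.1] at hs2
    exact hs ⟨hs2.1.le, hs2.2.trans hx3.2⟩

/-- Weak derivatives are unique up to null sets. -/
theorem HasWeakDeriv.unique {v v' w' : ℝ → ℝ} (h : HasWeakDeriv v v') (h2 : HasWeakDeriv v w') :
    ∀ᵐ x ∂(volume.restrict (Icc (-1 : ℝ) 1)), v' x = w' x := by
  obtain ⟨hi, c, hc⟩ := h
  obtain ⟨hj, d, hd⟩ := h2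
  have hk : IntervalIntegrable (fun x => v' x - w' x) volume (-1) 1 := hi.sub hj
  have hcont : ContinuousOn (fun x => ∫ s in (-1)..x, (v' s - w' s)) (Icc (-1) 1) := by
    have := intervalIntegral.continuousOn_primitive_interval' hk (a := -1) (by simp)
    rwa [uIcc_of_le (by norm_num)] at this
  have hae : ∀ᵐ x ∂(volume.restrict (Icc (-1 : ℝ) 1)),
      (∫ s in (-1)..x, (v' s - w' s)) = d - c := by
    filter_upwards [hc, hd, ae_restrict_mem measurableSet_Icc] with x hx hx2 hx3
    have hsub : uIcc (-1) x ⊆ uIcc (-1 : ℝ) 1 := by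
      rw [uIcc_of_le hx3.1, uIcc_of_le (by norm_num)]; exact Icc_subset_Icc_right hx3.2
    rw [intervalIntegral.integral_sub (hi.mono_set hsub) (hj.mono_set hsub)]
    linarith
  -- Continuity upgrades equality almost everywhere to equality on the whole interval; Lebesgue
  -- differentiation of the constant then gives `v' - w' = 0` almost everywhere.
  have heq : EqOn (fun x => ∫ s in (-1)..x, (v' s - w' s)) (fun _ => d - c) (Icc (-1) 1) :=
    Measure.eqOn_Icc_of_ae_eq volume (by norm_num) hae hcont continuousOn_const
  have hder := hk.ae_hasDerivAt_integral
  rw [← restrict_Ioo_eq_restrict_Icc, ae_restrict_iff' measurableSet_Ioo]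
  filter_upwards [hder] with x hx hx2
  have h1 := hx (by rw [uIcc_of_le (by norm_num)]; exact Ioo_subset_Icc_self hx2) (-1) (by simp)
  have h3 : HasDerivAt (fun x => ∫ s in (-1)..x, (v' s - w' s)) 0 x := by
    refine (hasDerivAt_const x (d - c)).congr_of_eventuallyEq ?_
    filter_upwards [Ioo_mem_nhds hx2.1 hx2.2] with y hy
    exact heq (Ioo_subset_Icc_self hy)
  exact sub_eq_zero.1 (h1.unique h3)

theorem MemH.congr {k : ℕ} {v w : ℝ → ℝ} (h : MemH k v)
    (hv : ∀ᵐ x ∂(volume.restrict (Icc (-1 : ℝ) 1)), v x = w x) : MemH k w := by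
  cases k with
  | zero => exact (memLp_congr_ae hv).1 h
  | succ k =>
    obtain ⟨h0, v', h1, h2⟩ := h
    exact ⟨(memLp_congr_ae hv).1 h0, v', h1.congr hv (ae_of_all _ fun _ => rfl), h2⟩

theorem MemH.memLp {k : ℕ} {v : ℝ → ℝ} (h : MemH k v) :
    MemLp v 2 (volume.restrict (Icc (-1 : ℝ) 1)) := by
  cases k with
  | zero => exact h
  | succ k => exact h.1

theorem MemH.hasWeakDeriv {k : ℕ} {v : ℝ → ℝ} (h : MemH (k + 1) v) :
    HasWeakDeriv v (weakDeriv v) := by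
  have hv : ∃ v', HasWeakDeriv v v' := ⟨_, h.2.choose_spec.1⟩
  rw [weakDeriv, dif_pos hv]
  exact hv.choose_spec

theorem MemH.of_hasWeakDeriv {k : ℕ} {v v' : ℝ → ℝ} (h : MemH (k + 1) v)
    (h' : HasWeakDeriv v v') : MemH k v' := by
  obtain ⟨_, w, h1, h2⟩ := h
  exact h2.congr (h1.unique h')

theorem MemH.iterate_weakDeriv {k : ℕ} (i : ℕ) {v : ℝ → ℝ} (h : MemH (k + i) v) :
    MemH k (weakDeriv^[i] v) := by
  induction i generalizing v with
  | zero => exact h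
  | succ i ih =>
    rw [Function.iterate_succ_apply]
    exact ih (MemH.of_hasWeakDeriv h (MemH.hasWeakDeriv h))

theorem MemH.hasWeakDeriv_iterate {k i : ℕ} (hi : i < k) {v : ℝ → ℝ} (h : MemH k v) :
    HasWeakDeriv (weakDeriv^[i] v) (weakDeriv^[i + 1] v) := by
  obtain ⟨j, rfl⟩ : ∃ j, k = (j + 1) + i := ⟨k - i - 1, by omega⟩
  rw [Function.iterate_succ_apply']
  exact (MemH.iterate_weakDeriv i h).hasWeakDeriv

theorem hasWeakDeriv_polynomial (q : Polynomial ℝ) :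
    HasWeakDeriv (fun x => q.eval x) (fun x => q.derivative.eval x) := by
  refine ⟨(Polynomial.continuous _).intervalIntegrable _ _, q.eval (-1), ae_of_all _ fun x => ?_⟩
  rw [intervalIntegral.integral_eq_sub_of_hasDerivAt (fun y _ => q.hasDerivAt y)
    ((Polynomial.continuous _).intervalIntegrable _ _)]
  ring

/-- The continuous representative of a weakly differentiable function. -/
theorem HasWeakDeriv.continuousOn {v v' : ℝ → ℝ} (h : HasWeakDeriv v v') (c : ℝ) :
    ContinuousOn (fun x => c + ∫ s in (-1)..x, v' s) (Icc (-1) 1) := by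
  have := intervalIntegral.continuousOn_primitive_interval' h.1 (a := -1) (by simp)
  rw [uIcc_of_le (by norm_num)] at this
  exact continuousOn_const.add this

/-! ### Gegenbauer coefficients of weak derivatives -/

open Polynomial in
-- Sturm–Liouville form of the differential equation for the `i`-th derivative of `T_k`, with
-- integrating factor `(1 - x²)^(i - 1/2)`.
theorem hasDerivAt_gegenbauer (k i : ℕ) {x : ℝ} (hx : x ∈ Ioo (-1 : ℝ) 1) :
    HasDerivAt (fun x => (1 - x ^ 2) ^ i * √(1 - x ^ 2) *
        (derivative^[i + 1] (Chebyshev.T ℝ k)).eval x)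
      (-((k : ℝ) ^ 2 - (i : ℝ) ^ 2) * (√(1 - x ^ 2)⁻¹ * ((1 - x ^ 2) ^ i *
        (derivative^[i] (Chebyshev.T ℝ k)).eval x))) x := by
  have h1 : (0 : ℝ) < 1 - x ^ 2 := by nlinarith [hx.1, hx.2]
  have h0 : HasDerivAt (fun x : ℝ => 1 - x ^ 2) (-(2 * x)) x := by
    simpa using (hasDerivAt_pow 2 x).const_sub 1
  have hs := h0.sqrt h1.ne'
  have hp := h0.pow i
  have hT := (derivative^[i + 1] (Chebyshev.T ℝ k)).hasDerivAt x
  have key := (hp.mul hs).mul hT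
  refine key.congr_deriv ?_
  have ode := Chebyshev.one_sub_X_sq_mul_iterate_derivative_T_eval (R := ℝ) k i x
  rw [← Function.iterate_succ_apply' derivative]
  set a := (derivative^[i] (Chebyshev.T ℝ k)).eval x
  set b := (derivative^[i + 1] (Chebyshev.T ℝ k)).eval x
  set c := (derivative^[i + 2] (Chebyshev.T ℝ k)).eval x
  have hs2 : √(1 - x ^ 2) ≠ 0 := (Real.sqrt_pos.2 h1).ne'
  have hs3 : √(1 - x ^ 2) ^ 2 = 1 - x ^ 2 := Real.sq_sqrt h1.le
  have hc : c = ((2 * i + 1) * x * b - ((k : ℝ) ^ 2 - (i : ℝ) ^ 2) * a) / (1 - x ^ 2) := by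
    rw [eq_div_iff h1.ne']
    push_cast at ode
    linarith
  -- For `i = 0` the truncated exponent `i - 1` is harmless, since the prefactor is zero.
  have hi : (i : ℝ) * (1 - x ^ 2) ^ (i - 1) = i * (1 - x ^ 2) ^ i / (1 - x ^ 2) := by
    cases i with
    | zero => simp
    | succ i => rw [eq_div_iff h1.ne', pow_succ, Nat.add_sub_cancel]; ring
  rw [hi, hc, Real.sqrt_inv]
  set r := √(1 - x ^ 2)
  simp only [Pi.pow_apply, Pi.mul_apply]
  rw [← hs3, Real.sqrt_sq (Real.sqrt_nonneg _)]
  field_simp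
  ring

open Polynomial in
-- Integration by parts against `φ = (1 - x²)^(i + 1/2) T_k^(i+1)`, which vanishes at both
-- endpoints, so no boundary terms appear. Since `φ'` may be singular there, the absolutely
-- continuous version of the formula is used.
theorem HasWeakDeriv.integral_gegenbauer {v v' : ℝ → ℝ} (h : HasWeakDeriv v v') (k i : ℕ) :
    ∫ x, (1 - x ^ 2) ^ (i + 1) * (v' x * (derivative^[i + 1] (Chebyshev.T ℝ k)).eval x) ∂measureT =
      ((k : ℝ) ^ 2 - (i : ℝ) ^ 2) *
        ∫ x, (1 - x ^ 2) ^ i * (v x * (derivative^[i] (Chebyshev.T ℝ k)).eval x) ∂measureT := by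
  obtain ⟨hi, c, hc⟩ := h
  rw [integral_one_sub_sq_pow_mul_measureT]
  set φ : ℝ → ℝ := fun x => (1 - x ^ 2) ^ i * √(1 - x ^ 2) *
        (derivative^[i + 1] (Chebyshev.T ℝ k)).eval x with hφ
  set φ' : ℝ → ℝ := fun x => -((k : ℝ) ^ 2 - (i : ℝ) ^ 2) * (√(1 - x ^ 2)⁻¹ * ((1 - x ^ 2) ^ i *
        (derivative^[i] (Chebyshev.T ℝ k)).eval x)) with hφ'
  have hφc : Continuous φ := by
    rw [hφ]; fun_prop
  have hφi : IntervalIntegrable φ' volume (-1) 1 := by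
    refine IntervalIntegrable.const_mul ?_ _
    exact Polynomial.Chebyshev.intervalIntegrable_sqrt_one_sub_sq_inv.mul_continuousOn
      (by fun_prop)
  have hsub : ∀ x ∈ Icc (-1 : ℝ) 1, uIcc (-1) x ⊆ uIcc (-1 : ℝ) 1 := by
    intro x hx
    rw [uIcc_of_le hx.1, uIcc_of_le (by norm_num)]; exact Icc_subset_Icc_right hx.2
  have hφint : ∀ x ∈ Icc (-1 : ℝ) 1, φ x = ∫ s in (-1)..x, φ' s := by
    intro x hx
    rw [intervalIntegral.integral_eq_sub_of_hasDerivAt_of_le hx.1 hφc.continuousOn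
      (fun y hy => hasDerivAt_gegenbauer k i ⟨hy.1, hy.2.trans_le hx.2⟩)
      (hφi.mono_set (hsub x hx))]
    simp [hφ]
  have hF := hi.absolutelyContinuousOnInterval_intervalIntegral (c := -1) (by simp)
  have hG := hφi.absolutelyContinuousOnInterval_intervalIntegral (c := -1) (by simp)
  have hparts := hF.integral_mul_deriv_eq_deriv_mul hG
  have hφ1 : ∫ s in (-1)..1, φ' s = 0 := by
    rw [← hφint 1 (by norm_num)]; simp [hφ]
  rw [hφ1, intervalIntegral.integral_same] at hparts
  have hd1 : ∀ᵐ x, x ∈ uIoc (-1 : ℝ) 1 → deriv (fun x => ∫ s in (-1)..x, v' s) x = v' x := by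
    filter_upwards [hi.ae_hasDerivAt_integral] with x hx hx2
    exact (hx (uIoc_subset_uIcc hx2) (-1) (by simp)).deriv
  have hd2 : ∀ᵐ x, x ∈ uIoc (-1 : ℝ) 1 → deriv (fun x => ∫ s in (-1)..x, φ' s) x = φ' x := by
    filter_upwards [hφi.ae_hasDerivAt_integral] with x hx hx2
    exact (hx (uIoc_subset_uIcc hx2) (-1) (by simp)).deriv
  have e1 : ∫ x in (-1)..1, (∫ s in (-1)..x, v' s) * deriv (fun x => ∫ s in (-1)..x, φ' s) x =
      ∫ x in (-1)..1, (∫ s in (-1)..x, v' s) * φ' x := by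
    refine intervalIntegral.integral_congr_ae ?_
    filter_upwards [hd2] with x hx hx2
    rw [hx hx2]
  have e2 : ∫ x in (-1)..1, deriv (fun x => ∫ s in (-1)..x, v' s) x * (∫ s in (-1)..x, φ' s) =
      ∫ x in (-1)..1, (1 - x ^ 2) ^ i * √(1 - x ^ 2) *
        (v' x * (derivative^[i + 1] (Chebyshev.T ℝ k)).eval x) := by
    refine intervalIntegral.integral_congr_ae ?_
    filter_upwards [hd1] with x hx hx2
    rw [hx hx2, ← hφint x (by rw [uIoc_of_le (by norm_num)] at hx2; exact Ioc_subset_Icc_self hx2)]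
    simp only [hφ]; ring
  rw [e1, e2] at hparts
  have hvi : IntervalIntegrable (fun x => (∫ s in (-1)..x, v' s) * φ' x) volume (-1) 1 :=
    hφi.continuousOn_mul hF.continuousOn
  -- The integration constant `c` drops out because `φ'` has integral zero.
  have e3 : ∫ x in (-1)..1, (c + ∫ s in (-1)..x, v' s) * φ' x =
      ∫ x in (-1)..1, (∫ s in (-1)..x, v' s) * φ' x := by
    simp only [add_mul]
    rw [intervalIntegral.integral_add (hφi.const_mul c) hvi, intervalIntegral.integral_const_mul,
      hφ1]
    simp
  have e4 : ((k : ℝ) ^ 2 - (i : ℝ) ^ 2) *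
        ∫ x, (1 - x ^ 2) ^ i * (v x * (derivative^[i] (Chebyshev.T ℝ k)).eval x) ∂measureT =
      -∫ x in (-1)..1, (c + ∫ s in (-1)..x, v' s) * φ' x := by
    rw [Polynomial.Chebyshev.integral_measureT, ← intervalIntegral.integral_const_mul,
      ← intervalIntegral.integral_neg]
    refine intervalIntegral.integral_congr_ae ?_
    filter_upwards [(ae_restrict_iff' measurableSet_Icc).1 hc] with x hx hx2
    rw [uIoc_of_le (by norm_num)] at hx2
    rw [← hx (Ioc_subset_Icc_self hx2)]
    simp only [hφ']; ring
  rw [e4, e3]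
  linarith

open Polynomial in
/-- The Chebyshev coefficients of a function determine the Gegenbauer coefficients of its weak
derivatives. -/
theorem integral_gegenbauer_eq_prod_mul {f : ℕ → ℝ → ℝ} {j : ℕ}
    (hf : ∀ i < j, HasWeakDeriv (f i) (f (i + 1))) (k : ℕ) :
    ∀ i ≤ j, ∫ x, (1 - x ^ 2) ^ i * (f i x * (derivative^[i] (Chebyshev.T ℝ k)).eval x) ∂measureT =
      (∏ l ∈ Finset.range i, ((k : ℝ) ^ 2 - (l : ℝ) ^ 2)) * chebInner (f 0) (chebT k) := by
  intro i
  induction i with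
  | zero => intro _; simp [chebInner, chebT]
  | succ i ih =>
    intro hi
    rw [(hf i hi).integral_gegenbauer k i, ih (by omega), Finset.prod_range_succ]
    ring

/-! ### The truncated Chebyshev series as a Hilbert-space projection -/

theorem chebInner_eq_inner {u v : ℝ → ℝ} {U V : Lp ℝ 2 measureT} (hu : u =ᵐ[measureT] U)
    (hv : v =ᵐ[measureT] V) : chebInner u v = inner ℝ U V := by
  rw [L2.inner_def, chebInner]
  refine integral_congr_ae ?_
  filter_upwards [hu, hv] with x hx hx2
  rw [hx, hx2]
  simp [mul_comm]

theorem chebNorm_eq_norm {u : ℝ → ℝ} {U : Lp ℝ 2 measureT} (hu : u =ᵐ[measureT] U) :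
    chebNorm u = ‖U‖ := by
  rw [chebNorm, chebInner_eq_inner hu hu, real_inner_self_eq_norm_sq, Real.sqrt_sq (norm_nonneg _)]

theorem memLp_polynomial (q : Polynomial ℝ) : MemLp (fun x => q.eval x) 2 measureT :=
  memLp_measureT_of_continuousOn (Polynomial.continuous q).continuousOn

/-- A polynomial as an element of the weighted `L²` space. -/
noncomputable def polyLp : Polynomial ℝ →ₗ[ℝ] Lp ℝ 2 measureT where
  toFun q := (memLp_polynomial q).toLp
  map_add' p q := by
    rw [← MemLp.toLp_add]
    congr 1
    ext x; simp
  map_smul' c q := by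
    rw [RingHom.id_apply, ← MemLp.toLp_const_smul]
    congr 1
    ext x; simp

theorem coeFn_polyLp (q : Polynomial ℝ) : (fun x => q.eval x) =ᵐ[measureT] polyLp q :=
  (MemLp.coeFn_toLp (memLp_polynomial q)).symm

/-- The polynomials of degree at most `n` as a subspace of the weighted `L²` space. -/
noncomputable def polySpace (n : ℕ) : Submodule ℝ (Lp ℝ 2 measureT) :=
  (Polynomial.degreeLT ℝ (n + 1)).map polyLp

instance (n : ℕ) : FiniteDimensional ℝ (polySpace n) := by
  have : FiniteDimensional ℝ (Polynomial.degreeLT ℝ (n + 1)) :=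
    LinearEquiv.finiteDimensional (Polynomial.degreeLTEquiv ℝ (n + 1)).symm
  unfold polySpace; infer_instance

theorem polyLp_mem_polySpace {n : ℕ} {q : Polynomial ℝ} (hq : q.natDegree ≤ n) :
    polyLp q ∈ polySpace n := by
  refine Submodule.mem_map_of_mem (Polynomial.mem_degreeLT.2 ?_)
  refine lt_of_le_of_lt Polynomial.degree_le_natDegree ?_
  exact_mod_cast Nat.lt_succ_of_le hq

theorem mem_polySpace_iff {n : ℕ} {U : Lp ℝ 2 measureT} :
    U ∈ polySpace n ↔ ∃ q : Polynomial ℝ, q.natDegree ≤ n ∧ polyLp q = U := by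
  refine ⟨?_, fun ⟨q, hq, h⟩ => h ▸ polyLp_mem_polySpace hq⟩
  rintro ⟨q, hq, rfl⟩
  refine ⟨q, ?_, rfl⟩
  have h : q.degree < ((n + 1 : ℕ) : WithBot ℕ) := Polynomial.mem_degreeLT.1 hq
  exact Polynomial.natDegree_le_iff_coeff_eq_zero.2 fun N hN =>
    Polynomial.coeff_eq_zero_of_degree_lt (h.trans_le (by exact_mod_cast hN))

/-- The polynomial `∑_{k ∈ I} a_k T_k`. -/
noncomputable def chebPoly (I : Finset ℕ) (a : ℕ → ℝ) : Polynomial ℝ :=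
  ∑ k ∈ I, a k • Polynomial.Chebyshev.T ℝ k

theorem chebSum_eq_eval (n : ℕ) (a : ℕ → ℝ) :
    chebSum n a = fun x => (chebPoly (Finset.range (n + 1)) a).eval x := by
  ext x
  simp [chebSum, chebPoly, chebT, Polynomial.eval_finsetSum]

theorem natDegree_T_le (k : ℕ) : (Polynomial.Chebyshev.T ℝ k).natDegree ≤ k := by
  rw [Polynomial.Chebyshev.natDegree_T]; simp

theorem natDegree_chebPoly_le (n : ℕ) (a : ℕ → ℝ) :
    (chebPoly (Finset.range (n + 1)) a).natDegree ≤ n := by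
  refine Polynomial.natDegree_sum_le_of_forall_le _ _ fun k hk => ?_
  exact (Polynomial.natDegree_smul_le _ _).trans
    ((natDegree_T_le k).trans (Nat.lt_succ_iff.1 (Finset.mem_range.1 hk)))

/-- `T_(n+1)` has degree exactly `n + 1`, so a multiple of it cancels the top coefficient and
induction applies. -/
theorem exists_eq_chebPoly (n : ℕ) : ∀ q : Polynomial ℝ, q.natDegree ≤ n →
    ∃ a, q = chebPoly (Finset.range (n + 1)) a := by
  induction n with
  | zero =>
    intro q hq
    refine ⟨fun _ => q.coeff 0, ?_⟩
    rw [Polynomial.eq_C_of_natDegree_le_zero hq]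
    simp [chebPoly, Polynomial.smul_eq_C_mul]
  | succ n ih =>
    intro q hq
    set T := Polynomial.Chebyshev.T ℝ (n + 1 : ℕ) with hT
    have hdeg : T.natDegree = n + 1 := by
      rw [hT, Polynomial.Chebyshev.natDegree_T, Int.natAbs_natCast]
    have hlead : T.coeff (n + 1) ≠ 0 := by
      rw [← hdeg, Polynomial.coeff_natDegree, Polynomial.leadingCoeff_ne_zero]
      exact Polynomial.Chebyshev.T_ne_zero _ _
    set c := q.coeff (n + 1) / T.coeff (n + 1) with hc
    obtain ⟨a, ha⟩ := ih (q - c • T) (by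
      rw [Polynomial.natDegree_le_iff_coeff_eq_zero]
      intro N hN
      rcases eq_or_lt_of_le (Nat.succ_le_of_lt hN) with h | h
      · rw [← h]
        simp only [Polynomial.coeff_sub, Polynomial.coeff_smul, smul_eq_mul, hc]
        rw [Nat.succ_eq_add_one, div_mul_cancel₀ _ hlead, sub_self]
      · rw [Polynomial.coeff_sub, Polynomial.coeff_smul,
          Polynomial.coeff_eq_zero_of_natDegree_lt (by omega),
          Polynomial.coeff_eq_zero_of_natDegree_lt (by omega)]
        simp)
    refine ⟨fun k => if k = n + 1 then c else a k, ?_⟩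
    rw [chebPoly, Finset.sum_range_succ, if_pos rfl]
    rw [sub_eq_iff_eq_add] at ha
    rw [ha, chebPoly]
    congr 1
    refine Finset.sum_congr rfl fun k hk => ?_
    rw [if_neg (by have := Finset.mem_range.1 hk; omega)]

theorem chebInner_T_of_ne {k l : ℕ} (h : k ≠ l) : chebInner (chebT k) (chebT l) = 0 :=
  Polynomial.Chebyshev.integral_eval_T_real_mul_eval_T_real_measureT_of_ne h

theorem chebInner_T_self_pos (k : ℕ) : 0 < chebInner (chebT k) (chebT k) := by
  rcases eq_or_ne k 0 with rfl | h
  · have := Polynomial.Chebyshev.integral_eval_T_real_mul_self_measureT_zero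
    rw [chebInner]; simp only [chebT]; rw [Nat.cast_zero, this]; exact Real.pi_pos
  · have := Polynomial.Chebyshev.integral_T_real_mul_self_measureT_of_ne_zero h
    rw [chebInner]; simp only [chebT]; rw [this]; exact Real.pi_div_two_pos

theorem inner_polyLp_T (k l : ℕ) :
    inner ℝ (polyLp (Polynomial.Chebyshev.T ℝ k)) (polyLp (Polynomial.Chebyshev.T ℝ l)) =
      chebInner (chebT k) (chebT l) :=
  (chebInner_eq_inner (coeFn_polyLp _) (coeFn_polyLp _)).symm

theorem inner_polyLp_chebPoly (I : Finset ℕ) (a : ℕ → ℝ) (l : ℕ) :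
    inner ℝ (polyLp (chebPoly I a)) (polyLp (Polynomial.Chebyshev.T ℝ l)) =
      if l ∈ I then a l * chebInner (chebT l) (chebT l) else 0 := by
  simp only [chebPoly, map_sum, map_smul, sum_inner, real_inner_smul_left, inner_polyLp_T]
  split_ifs with h
  · rw [Finset.sum_eq_single_of_mem l h]
    intro k _ hk
    rw [chebInner_T_of_ne hk, mul_zero]
  · refine Finset.sum_eq_zero fun k hk => ?_
    rw [chebInner_T_of_ne (by rintro rfl; exact h hk), mul_zero]

theorem inner_polyLp_T_eq_chebCoeff_mul {u : ℝ → ℝ} {U : Lp ℝ 2 measureT} (hu : u =ᵐ[measureT] U)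
    (k : ℕ) : inner ℝ U (polyLp (Polynomial.Chebyshev.T ℝ k)) =
      chebCoeff u k * chebInner (chebT k) (chebT k) := by
  rw [chebCoeff, div_mul_cancel₀ _ (chebInner_T_self_pos k).ne']
  exact (chebInner_eq_inner hu (coeFn_polyLp _)).symm

/-- The truncated Chebyshev series is the orthogonal projection onto the polynomials. -/
theorem starProjection_eq_chebPoly {u : ℝ → ℝ} {U : Lp ℝ 2 measureT} (hu : u =ᵐ[measureT] U)
    (n : ℕ) : (polySpace n).starProjection U =
      polyLp (chebPoly (Finset.range (n + 1)) (chebCoeff u)) := by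
  refine Submodule.eq_starProjection_of_mem_of_inner_eq_zero
    (polyLp_mem_polySpace (natDegree_chebPoly_le n _)) fun W hW => ?_
  obtain ⟨q, hq, rfl⟩ := mem_polySpace_iff.1 hW
  obtain ⟨b, rfl⟩ := exists_eq_chebPoly n q hq
  have h : ∀ k ∈ Finset.range (n + 1),
      inner ℝ (U - polyLp (chebPoly (Finset.range (n + 1)) (chebCoeff u)))
        (polyLp (Polynomial.Chebyshev.T ℝ k)) = 0 := fun k hk => by
    rw [inner_sub_left, inner_polyLp_T_eq_chebCoeff_mul hu, inner_polyLp_chebPoly, if_pos hk,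
      sub_self]
  generalize U - polyLp (chebPoly (Finset.range (n + 1)) (chebCoeff u)) = V at h ⊢
  simp only [chebPoly, map_sum, map_smul, inner_sum, real_inner_smul_right]
  exact Finset.sum_eq_zero fun k hk => by rw [h k hk, mul_zero]

theorem chebProj_ae_eq {u : ℝ → ℝ} {U : Lp ℝ 2 measureT} (hu : u =ᵐ[measureT] U) (n : ℕ) :
    chebProj n u =ᵐ[measureT] (polySpace n).starProjection U := by
  rw [starProjection_eq_chebPoly hu, chebProj, chebSum_eq_eval]
  exact coeFn_polyLp _

/-- The projection onto `Kᗮ` kills `w`, so the residual is also the projection of `U - w`. -/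
theorem norm_sub_starProjection_le {E : Type*} [NormedAddCommGroup E] [InnerProductSpace ℝ E]
    (K : Submodule ℝ E) [K.HasOrthogonalProjection] (U : E) {w : E} (hw : w ∈ K) :
    ‖U - K.starProjection U‖ ≤ ‖U - w‖ := by
  have h : U - K.starProjection U = Kᗮ.starProjection (U - w) := by
    rw [Submodule.starProjection_orthogonal_val, map_sub,
      Submodule.starProjection_eq_self_iff.2 hw]
    abel
  rw [h]
  exact Submodule.norm_starProjection_apply_le _ _

theorem norm_sub_starProjection_le_norm {E : Type*} [NormedAddCommGroup E] [InnerProductSpace ℝ E]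
    (K : Submodule ℝ E) [K.HasOrthogonalProjection] (U : E) :
    ‖U - K.starProjection U‖ ≤ ‖U‖ := by
  simpa using norm_sub_starProjection_le K U K.zero_mem

/-! ### Rate of convergence of the truncated Chebyshev series -/

/-- Converts the Gegenbauer factor into a power of the frequency. For `k < j` the product contains a
zero factor and the summand `1` suffices; for `k ≥ j` each factor satisfies `k² ≤ j (k² - l²)`. -/
theorem pow_le_pow_mul_one_add_prod (k j : ℕ) :
    (k : ℝ) ^ (2 * j) ≤
      (j : ℝ) ^ (2 * j) * (1 + ∏ l ∈ Finset.range j, ((k : ℝ) ^ 2 - (l : ℝ) ^ 2)) := by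
  have hj0 : (0 : ℝ) ≤ j := j.cast_nonneg
  have hk0 : (0 : ℝ) ≤ k := k.cast_nonneg
  rcases lt_or_ge k j with h | h
  · rw [Finset.prod_eq_zero (Finset.mem_range.2 h) (sub_self _), add_zero, mul_one]
    exact pow_le_pow_left₀ hk0 (by exact_mod_cast h.le) _
  · have hkj : (j : ℝ) ≤ k := by exact_mod_cast h
    have h1 : (k : ℝ) ^ (2 * j) ≤
        (j : ℝ) ^ j * ∏ l ∈ Finset.range j, ((k : ℝ) ^ 2 - (l : ℝ) ^ 2) := by
      have e : (j : ℝ) ^ j = ∏ _l ∈ Finset.range j, (j : ℝ) := by simp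
      have e' : (k : ℝ) ^ (2 * j) = ∏ _l ∈ Finset.range j, (k : ℝ) ^ 2 := by simp [pow_mul]
      rw [e, e', ← Finset.prod_mul_distrib]
      refine Finset.prod_le_prod (fun _ _ => by positivity) fun l hl => ?_
      have hl1 : (l : ℝ) + 1 ≤ j := by exact_mod_cast Finset.mem_range.1 hl
      have hl0 : (0 : ℝ) ≤ l := l.cast_nonneg
      have hlk : (l : ℝ) ≤ k := by linarith
      -- From `l ≤ j - 1`: `j (k - l) - k ≥ (j - 1)(k - j) ≥ 0`.
      have h1 : (k : ℝ) ≤ j * (k - l) := by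
        nlinarith [mul_nonneg (sub_nonneg.2 hkj) (sub_nonneg.2 hl1),
          mul_nonneg hl0 (sub_nonneg.2 hl1), mul_nonneg hl0 (sub_nonneg.2 hkj)]
      calc (k : ℝ) ^ 2 = k * k := sq _
        _ ≤ j * (k - l) * (k + l) :=
          mul_le_mul h1 (by linarith) hk0 (mul_nonneg hj0 (sub_nonneg.2 hlk))
        _ = j * (k ^ 2 - l ^ 2) := by ring
    have h2 : (1 : ℝ) ≤ (j : ℝ) ^ j := by
      rcases Nat.eq_zero_or_pos j with rfl | hj
      · simp
      · exact one_le_pow₀ (by exact_mod_cast hj)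
    have h3 : (0 : ℝ) ≤ ∏ l ∈ Finset.range j, ((k : ℝ) ^ 2 - (l : ℝ) ^ 2) := by
      refine Finset.prod_nonneg fun l hl => sub_nonneg.2 (pow_le_pow_left₀ l.cast_nonneg ?_ 2)
      exact_mod_cast (Finset.mem_range.1 hl).le.trans h
    set Q := ∏ l ∈ Finset.range j, ((k : ℝ) ^ 2 - (l : ℝ) ^ 2)
    rw [two_mul, pow_add (j : ℝ) j j, mul_assoc]
    rw [two_mul] at h1
    nlinarith [mul_nonneg (sub_nonneg.2 h2) (mul_nonneg (by positivity : (0 : ℝ) ≤ (j : ℝ) ^ j) h3),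
      (by positivity : (0 : ℝ) ≤ (j : ℝ) ^ j * (j : ℝ) ^ j)]

theorem integrable_weight_mul_polynomial (i : ℕ) {f : ℝ → ℝ}
    (hf : MemLp f 2 (volume.restrict (Icc (-1 : ℝ) 1))) (q : Polynomial ℝ) :
    Integrable (fun x => (1 - x ^ 2) ^ (i + 1) * (f x * q.eval x)) measureT :=
  integrable_one_sub_sq_pow_mul_measureT i
    ((intervalIntegrable_of_memLp hf).mul_continuousOn (Polynomial.continuous q).continuousOn)

open Polynomial in
-- Serves twice in Bessel's inequality: with `f` the chain of weak derivatives (cross term) and with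
-- `f` the derivatives of the polynomial itself (square term).
theorem integral_weight_mul_chebPoly {f : ℕ → ℝ → ℝ} {i : ℕ}
    (hf : ∀ l < i + 1, HasWeakDeriv (f l) (f (l + 1)))
    (hm : MemLp (f (i + 1)) 2 (volume.restrict (Icc (-1 : ℝ) 1))) (I : Finset ℕ) (d : ℕ → ℝ) :
    ∫ x, (1 - x ^ 2) ^ (i + 1) * (f (i + 1) x * (derivative^[i + 1] (chebPoly I d)).eval x)
        ∂measureT =
      ∑ k ∈ I, d k * ((∏ l ∈ Finset.range (i + 1), ((k : ℝ) ^ 2 - (l : ℝ) ^ 2)) *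
        chebInner (f 0) (chebT k)) := by
  have e : ∀ x, (1 - x ^ 2) ^ (i + 1) * (f (i + 1) x *
      (derivative^[i + 1] (chebPoly I d)).eval x) =
      ∑ k ∈ I, d k * ((1 - x ^ 2) ^ (i + 1) * (f (i + 1) x *
        (derivative^[i + 1] (Chebyshev.T ℝ k)).eval x)) := fun x => by
    rw [chebPoly, iterate_derivative_sum, eval_finsetSum, Finset.mul_sum, Finset.mul_sum]
    refine Finset.sum_congr rfl fun k _ => ?_
    rw [iterate_derivative_smul, eval_smul, smul_eq_mul]
    ring
  simp only [e]
  rw [integral_finsetSum _ fun k _ => (integrable_weight_mul_polynomial i hm _).const_mul _]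
  refine Finset.sum_congr rfl fun k _ => ?_
  rw [integral_const_mul, integral_gegenbauer_eq_prod_mul hf k (i + 1) le_rfl]

/-- This is `(1 - x²)^(i+1) w ≤ 1`, the reason why unweighted norms of the derivatives suffice. -/
theorem one_sub_sq_pow_mul_sqrt_le_one (i : ℕ) {x : ℝ} (hx : x ∈ Icc (-1 : ℝ) 1) :
    (1 - x ^ 2) ^ i * √(1 - x ^ 2) ≤ 1 := by
  have h : (0 : ℝ) ≤ 1 - x ^ 2 := by nlinarith [hx.1, hx.2]
  have h' : 1 - x ^ 2 ≤ 1 := by nlinarith [sq_nonneg x]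
  exact mul_le_one₀ (pow_le_one₀ h h') (Real.sqrt_nonneg _) (Real.sqrt_le_one.2 h')

open Polynomial in
/-- Bessel's inequality for the Gegenbauer expansion of a weak derivative. -/
theorem sum_chebCoeff_sq_mul_prod_le {f : ℕ → ℝ → ℝ} {i : ℕ}
    (hf : ∀ l < i + 1, HasWeakDeriv (f l) (f (l + 1)))
    (hm : MemLp (f (i + 1)) 2 (volume.restrict (Icc (-1 : ℝ) 1))) (I : Finset ℕ) :
    ∑ k ∈ I, chebCoeff (f 0) k ^ 2 * chebInner (chebT k) (chebT k) *
        ∏ l ∈ Finset.range (i + 1), ((k : ℝ) ^ 2 - (l : ℝ) ^ 2) ≤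
      ∫ x in (-1)..1, f (i + 1) x ^ 2 := by
  set d := chebCoeff (f 0) with hd
  set S := chebPoly I d with hS
  set Q := ∑ k ∈ I, d k ^ 2 * chebInner (chebT k) (chebT k) *
        ∏ l ∈ Finset.range (i + 1), ((k : ℝ) ^ 2 - (l : ℝ) ^ 2) with hQ
  have h1 : ∫ x, (1 - x ^ 2) ^ (i + 1) * (f (i + 1) x * (derivative^[i + 1] S).eval x)
      ∂measureT = Q := by
    rw [hS, integral_weight_mul_chebPoly hf hm]
    refine Finset.sum_congr rfl fun k _ => ?_
    have : chebInner (f 0) (chebT k) = d k * chebInner (chebT k) (chebT k) := by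
      rw [hd, chebCoeff, div_mul_cancel₀ _ (chebInner_T_self_pos k).ne']
    rw [this]; ring
  have hSm : ∀ q : ℝ[X], MemLp (fun x => q.eval x) 2 (volume.restrict (Icc (-1 : ℝ) 1)) :=
    fun q => memLp_restrict_of_memLp_measureT (memLp_polynomial q)
  have h2 : ∫ x, (1 - x ^ 2) ^ (i + 1) * ((derivative^[i + 1] S).eval x *
      (derivative^[i + 1] S).eval x) ∂measureT = Q := by
    have hc : ∀ l < i + 1, HasWeakDeriv ((fun l x => (derivative^[l] S).eval x : ℕ → ℝ → ℝ) l)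
        ((fun l x => (derivative^[l] S).eval x : ℕ → ℝ → ℝ) (l + 1)) := fun l _ => by
      simp only [Function.iterate_succ_apply']
      exact hasWeakDeriv_polynomial _
    have := integral_weight_mul_chebPoly hc (hSm _) I d
    rw [← hS] at this
    rw [this]
    refine Finset.sum_congr rfl fun k hk => ?_
    have : chebInner (fun x => S.eval x) (chebT k) = d k * chebInner (chebT k) (chebT k) := by
      rw [chebInner_eq_inner (v := chebT k) (coeFn_polyLp S) (coeFn_polyLp (Chebyshev.T ℝ k)), hS,
        inner_polyLp_chebPoly, if_pos hk]
    simp only [Function.iterate_zero, id_eq]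
    rw [this]; ring
  have hsq : IntervalIntegrable (fun x => f (i + 1) x ^ 2) volume (-1) 1 := by
    rw [intervalIntegrable_iff_integrableOn_Icc_of_le (by norm_num)]
    exact hm.integrable_sq
  have i1 := integrable_one_sub_sq_pow_mul_measureT i hsq
  have i2 := integrable_weight_mul_polynomial i hm (derivative^[i + 1] S)
  have i3 := integrable_weight_mul_polynomial i (hSm (derivative^[i + 1] S)) (derivative^[i + 1] S)
  -- Expanding the weighted square of `f (i + 1) - S^(i+1)`: the cross integral and the square
  -- integral both equal `Q`, so `Q` is at most the weighted integral of `f (i + 1) ^ 2`.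
  have h3 : 0 ≤ ∫ x, ((1 - x ^ 2) ^ (i + 1) * f (i + 1) x ^ 2 -
      2 * ((1 - x ^ 2) ^ (i + 1) * (f (i + 1) x * (derivative^[i + 1] S).eval x)) +
      (1 - x ^ 2) ^ (i + 1) * ((derivative^[i + 1] S).eval x *
      (derivative^[i + 1] S).eval x)) ∂measureT := by
    refine integral_nonneg_of_ae (ae_measureT_mem_Icc.mono fun x hx => ?_)
    have h : (0 : ℝ) ≤ 1 - x ^ 2 := by nlinarith [hx.1, hx.2]
    have : (0 : ℝ) ≤ (1 - x ^ 2) ^ (i + 1) * (f (i + 1) x - (derivative^[i + 1] S).eval x) ^ 2 := by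
      positivity
    simp only [Pi.zero_apply]
    linarith
  have i12 : Integrable (fun x => (1 - x ^ 2) ^ (i + 1) * f (i + 1) x ^ 2 -
      2 * ((1 - x ^ 2) ^ (i + 1) * (f (i + 1) x * (derivative^[i + 1] S).eval x))) measureT :=
    i1.sub (i2.const_mul 2)
  rw [integral_add i12 i3, integral_sub i1 (i2.const_mul 2),
    integral_const_mul, h1, h2] at h3
  refine le_trans (by linarith) (?_ : ∫ x, (1 - x ^ 2) ^ (i + 1) * f (i + 1) x ^ 2 ∂measureT ≤ _)
  rw [integral_one_sub_sq_pow_mul_measureT]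
  refine intervalIntegral.integral_mono_on (by norm_num)
    (hsq.continuousOn_mul (by fun_prop)) hsq fun x hx => ?_
  exact mul_le_of_le_one_left (sq_nonneg _) (one_sub_sq_pow_mul_sqrt_le_one i hx)

theorem starProjection_sub_starProjection {u : ℝ → ℝ} {U : Lp ℝ 2 measureT} (hu : u =ᵐ[measureT] U)
    {n M : ℕ} (h : n ≤ M) :
    (polySpace M).starProjection U - (polySpace n).starProjection U =
      polyLp (chebPoly (Finset.Ico (n + 1) (M + 1)) (chebCoeff u)) := by
  rw [starProjection_eq_chebPoly hu, starProjection_eq_chebPoly hu, ← map_sub]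
  congr 1
  exact (Finset.sum_Ico_eq_sub _ (by omega)).symm

theorem inner_chebPoly_chebCoeff {u : ℝ → ℝ} {U : Lp ℝ 2 measureT} (hu : u =ᵐ[measureT] U)
    (I : Finset ℕ) : inner ℝ U (polyLp (chebPoly I (chebCoeff u))) =
      ∑ k ∈ I, chebCoeff u k ^ 2 * chebInner (chebT k) (chebT k) := by
  rw [chebPoly]
  simp only [map_sum, map_smul, inner_sum, real_inner_smul_right, inner_polyLp_T_eq_chebCoeff_mul hu]
  exact Finset.sum_congr rfl fun k _ => by ring

theorem norm_chebPoly_chebCoeff_sq (u : ℝ → ℝ) (I : Finset ℕ) :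
    ‖polyLp (chebPoly I (chebCoeff u))‖ ^ 2 =
      ∑ k ∈ I, chebCoeff u k ^ 2 * chebInner (chebT k) (chebT k) := by
  rw [← real_inner_self_eq_norm_sq]
  nth_rewrite 2 [chebPoly]
  simp only [map_sum, map_smul, inner_sum, real_inner_smul_right, inner_polyLp_chebPoly]
  exact Finset.sum_congr rfl fun k hk => by rw [if_pos hk]; ring

/-- Bessel's inequality: the sum is both `(U, S)` and `‖S‖²` for the partial sum `S`, and `2 (U, S)
≤ ‖U‖² + ‖S‖²`. -/
theorem sum_chebCoeff_sq_le {u : ℝ → ℝ} {U : Lp ℝ 2 measureT} (hu : u =ᵐ[measureT] U)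
    (I : Finset ℕ) :
    ∑ k ∈ I, chebCoeff u k ^ 2 * chebInner (chebT k) (chebT k) ≤ ‖U‖ ^ 2 := by
  have h1 := inner_chebPoly_chebCoeff hu I
  have h2 := norm_chebPoly_chebCoeff_sq u I
  have h3 := real_inner_le_norm U (polyLp (chebPoly I (chebCoeff u)))
  set s := ∑ k ∈ I, chebCoeff u k ^ 2 * chebInner (chebT k) (chebT k)
  nlinarith [sq_nonneg (‖U‖ - ‖polyLp (chebPoly I (chebCoeff u))‖)]

/-- Polynomials approximate functions with a weak derivative. -/
theorem exists_norm_sub_starProjection_lt {u u' : ℝ → ℝ} {U : Lp ℝ 2 measureT}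
    (hu : u =ᵐ[measureT] U) (h : HasWeakDeriv u u') {ε : ℝ} (hε : 0 < ε) (n : ℕ) :
    ∃ M ≥ n, ‖U - (polySpace M).starProjection U‖ < ε := by
  obtain ⟨c, hc⟩ := h.2
  -- The `L²_w` norm of the constant `1`, in the form in which `Lp.norm_le_of_ae_bound` produces it.
  -- Weierstrass approximation of the continuous representative within `ε / (r + 1)` then gives
  -- `L²_w` distance below `ε`.
  set r := (measureT.real univ) ^ (ENNReal.toReal 2)⁻¹ with hr
  have hr0 : 0 ≤ r := Real.rpow_nonneg measureReal_nonneg _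
  obtain ⟨q, hq⟩ := exists_polynomial_near_of_continuousOn (-1) 1 _ (h.continuousOn c)
    (ε / (r + 1)) (by positivity)
  refine ⟨max n q.natDegree, le_max_left _ _, ?_⟩
  refine (norm_sub_starProjection_le _ U
    (polyLp_mem_polySpace (le_max_right n q.natDegree))).trans_lt ?_
  have hb : ∀ᵐ x ∂measureT, ‖(U - polyLp q : Lp ℝ 2 measureT) x‖ ≤ ε / (r + 1) := by
    filter_upwards [Lp.coeFn_sub U (polyLp q), hu, coeFn_polyLp q, ae_measureT_iff.2 hc,
      ae_measureT_mem_Icc] with x h1 h2 h3 h4 h5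
    rw [h1, Pi.sub_apply, ← h2, ← h3, h4, Real.norm_eq_abs, abs_sub_comm]
    exact (hq x h5).le
  refine (Lp.norm_le_of_ae_bound (by positivity) hb).trans_lt ?_
  change r * (ε / (r + 1)) < ε
  rw [mul_div_assoc', div_lt_iff₀ (by positivity)]
  nlinarith

theorem sobolevSq_nonneg (k : ℕ) (v : ℝ → ℝ) : 0 ≤ sobolevSq k v :=
  add_nonneg (integral_nonneg fun _ => mul_self_nonneg _) (Finset.sum_nonneg fun _ _ =>
    intervalIntegral.integral_nonneg (by norm_num) fun _ _ => sq_nonneg _)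

theorem sobolevNorm_sq (k : ℕ) (v : ℝ → ℝ) : sobolevNorm k v ^ 2 = sobolevSq k v :=
  Real.sq_sqrt (sobolevSq_nonneg k v)

theorem sobolevNorm_nonneg (k : ℕ) (v : ℝ → ℝ) : 0 ≤ sobolevNorm k v := Real.sqrt_nonneg _

theorem norm_le_sobolevNorm (k : ℕ) (U : Lp ℝ 2 measureT) : ‖U‖ ≤ sobolevNorm k U := by
  rw [← chebNorm_eq_norm (Filter.EventuallyEq.refl _ _)]
  exact Real.sqrt_le_sqrt (le_add_of_nonneg_right (Finset.sum_nonneg fun _ _ =>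
    intervalIntegral.integral_nonneg (by norm_num) fun _ _ => sq_nonneg _))

/-- The approximation property of the truncated Chebyshev series. -/
theorem norm_sub_starProjection_le_sobolevNorm {k : ℕ} {U : Lp ℝ 2 measureT} (hU : MemH k U)
    (n : ℕ) :
    ((n : ℝ) + 1) ^ k * ‖U - (polySpace n).starProjection U‖ ≤ (k : ℝ) ^ k * sobolevNorm k U := by
  cases k with
  | zero =>
    simpa using (norm_sub_starProjection_le_norm _ U).trans (norm_le_sobolevNorm 0 U)
  | succ i =>
    set k := i + 1 with hk
    have hrefl : (U : ℝ → ℝ) =ᵐ[measureT] U := Filter.EventuallyEq.refl _ _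
    have hchain : ∀ l < i + 1, HasWeakDeriv ((fun l => weakDeriv^[l] U) l)
        ((fun l => weakDeriv^[l] U) (l + 1)) := fun l hl => hU.hasWeakDeriv_iterate hl
    have hmem : MemLp (weakDeriv^[i + 1] U) 2 (volume.restrict (Icc (-1 : ℝ) 1)) :=
      (MemH.iterate_weakDeriv (k := 0) (i + 1) (by rwa [Nat.zero_add])).memLp
    have hsob : ‖U‖ ^ 2 + ∫ x in (-1)..1, (weakDeriv^[i + 1] U) x ^ 2 ≤ sobolevNorm k U ^ 2 := by
      rw [sobolevNorm_sq, sobolevSq, chebInner_eq_inner hrefl hrefl, real_inner_self_eq_norm_sq]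
      gcongr
      exact Finset.single_le_sum (f := fun j => ∫ x in (-1)..1, (weakDeriv^[j] U) x ^ 2)
        (fun _ _ => intervalIntegral.integral_nonneg (by norm_num) fun _ _ => sq_nonneg _)
        (Finset.mem_Icc.2 ⟨by omega, le_rfl⟩)
    have hn0 : (0 : ℝ) ≤ n := n.cast_nonneg
    -- Truncating at `M` keeps all sums finite. Only frequencies `j ≥ n + 1` remain, and their
    -- factor `(n + 1)^(2k)` is absorbed by the two Bessel inequalities, for `U` and for its `k`-th
    -- derivative.
    have hdiff : ∀ M ≥ n, ((n : ℝ) + 1) ^ k *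
        ‖(polySpace M).starProjection U - (polySpace n).starProjection U‖ ≤
          (k : ℝ) ^ k * sobolevNorm k U := by
      intro M hM
      refine le_of_sq_le_sq ?_ (mul_nonneg (by positivity) (sobolevNorm_nonneg _ _))
      rw [starProjection_sub_starProjection hrefl hM, mul_pow, norm_chebPoly_chebCoeff_sq, mul_pow]
      have hb1 := sum_chebCoeff_sq_le hrefl (Finset.Ico (n + 1) (M + 1))
      have hb2 := sum_chebCoeff_sq_mul_prod_le hchain hmem (Finset.Ico (n + 1) (M + 1))
      simp only [Function.iterate_zero, id_eq] at hb2
      calc _ ≤ ((k : ℝ) ^ k) ^ 2 * ∑ j ∈ Finset.Ico (n + 1) (M + 1),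
            (chebCoeff U j ^ 2 * chebInner (chebT j) (chebT j) +
              chebCoeff U j ^ 2 * chebInner (chebT j) (chebT j) *
                ∏ l ∈ Finset.range k, ((j : ℝ) ^ 2 - (l : ℝ) ^ 2)) := by
            rw [Finset.mul_sum, Finset.mul_sum]
            refine Finset.sum_le_sum fun j hj => ?_
            have hj1 : (n : ℝ) + 1 ≤ j := by exact_mod_cast (Finset.mem_Ico.1 hj).1
            have h0 : 0 ≤ chebCoeff U j ^ 2 * chebInner (chebT j) (chebT j) :=
              mul_nonneg (sq_nonneg _) (chebInner_T_self_pos j).le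
            have h1 : (((n : ℝ) + 1) ^ k) ^ 2 ≤ (j : ℝ) ^ (2 * k) := by
              rw [← pow_mul, mul_comm k 2]; gcongr
            have h2 := h1.trans (pow_le_pow_mul_one_add_prod j k)
            have h3 : ((k : ℝ) ^ k) ^ 2 = (k : ℝ) ^ (2 * k) := by rw [← pow_mul, mul_comm]
            rw [h3]
            linarith [mul_le_mul_of_nonneg_right h2 h0]
        _ ≤ _ := by
            rw [Finset.sum_add_distrib]
            gcongr
            linarith
    -- The tail beyond a suitable `M` is arbitrarily small by density of polynomials.
    refine le_of_forall_pos_le_add fun ε hε => ?_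
    obtain ⟨M, hM, hM2⟩ := exists_norm_sub_starProjection_lt hrefl (hchain 0 (by omega))
      (div_pos hε (by positivity : (0 : ℝ) < ((n : ℝ) + 1) ^ k)) n
    rw [lt_div_iff₀ (by positivity)] at hM2
    have htri : ‖U - (polySpace n).starProjection U‖ ≤ ‖U - (polySpace M).starProjection U‖ +
        ‖(polySpace M).starProjection U - (polySpace n).starProjection U‖ :=
      norm_sub_le_norm_sub_add_norm_sub _ _ _
    calc _ ≤ ((n : ℝ) + 1) ^ k * (‖U - (polySpace M).starProjection U‖ +
        ‖(polySpace M).starProjection U - (polySpace n).starProjection U‖) := by gcongr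
      _ ≤ _ := by rw [mul_add]; linarith [hdiff M hM]

/-! ### Partial-integral operators as bounded operators on the weighted space -/

/-- A measurable kernel that is bounded on the square `[-1, 1] × [-1, 1]`. -/
structure BoundedKernel (N : ℝ → ℝ → ℝ) : Prop where
  measurable : Measurable (Function.uncurry N)
  bounded : ∃ M : ℝ, ∀ x ∈ Icc (-1 : ℝ) 1, ∀ s ∈ Icc (-1 : ℝ) 1, |N x s| ≤ M

namespace BoundedKernel

theorem of_continuous {N : ℝ → ℝ → ℝ} (h : Continuous (Function.uncurry N)) : BoundedKernel N := by
  refine ⟨h.measurable, ?_⟩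
  obtain ⟨M, hM⟩ := (isCompact_Icc.prod isCompact_Icc : IsCompact
    (Icc (-1 : ℝ) 1 ×ˢ Icc (-1 : ℝ) 1)).exists_bound_of_continuousOn h.continuousOn
  exact ⟨M, fun x hx s hs => hM (x, s) ⟨hx, hs⟩⟩

theorem of_left {A : ℝ → ℝ} (h : Measurable A) (hb : ∃ M : ℝ, ∀ x ∈ Icc (-1 : ℝ) 1, |A x| ≤ M) :
    BoundedKernel fun x _ => A x :=
  ⟨h.comp measurable_fst, hb.imp fun _ hM x hx _ _ => hM x hx⟩

theorem const (c : ℝ) : BoundedKernel fun _ _ => c :=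
  of_continuous continuous_const

theorem add {N L : ℝ → ℝ → ℝ} (hN : BoundedKernel N) (hL : BoundedKernel L) :
    BoundedKernel fun x s => N x s + L x s := by
  obtain ⟨M, hM⟩ := hN.bounded
  obtain ⟨M', hM'⟩ := hL.bounded
  exact ⟨hN.measurable.add hL.measurable, M + M', fun x hx s hs =>
    (abs_add_le _ _).trans (add_le_add (hM x hx s hs) (hM' x hx s hs))⟩

theorem mul {N L : ℝ → ℝ → ℝ} (hN : BoundedKernel N) (hL : BoundedKernel L) :
    BoundedKernel fun x s => N x s * L x s := by
  obtain ⟨M, hM⟩ := hN.bounded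
  obtain ⟨M', hM'⟩ := hL.bounded
  refine ⟨hN.measurable.mul hL.measurable, M * M', fun x hx s hs => ?_⟩
  rw [abs_mul]
  exact mul_le_mul (hM x hx s hs) (hM' x hx s hs) (abs_nonneg _)
    ((abs_nonneg _).trans (hM x hx s hs))

variable {N : ℝ → ℝ → ℝ}

theorem intervalIntegrable_mul (hN : BoundedKernel N) {v : ℝ → ℝ}
    (hv : IntervalIntegrable v volume (-1) 1) {x : ℝ} (hx : x ∈ Icc (-1 : ℝ) 1) :
    IntervalIntegrable (fun s => N x s * v s) volume (-1) 1 := by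
  obtain ⟨M, hM⟩ := hN.bounded
  rw [intervalIntegrable_iff_integrableOn_Icc_of_le (by norm_num)] at hv ⊢
  refine Integrable.bdd_mul (c := M) hv ?_ ?_
  · exact (hN.measurable.comp (measurable_const.prodMk measurable_id)).aestronglyMeasurable
  · filter_upwards [ae_restrict_mem measurableSet_Icc] with s hs
    exact hM x hx s hs

theorem intervalIntegrable_mul_left (hN : BoundedKernel N) {v : ℝ → ℝ}
    (hv : IntervalIntegrable v volume (-1) 1) {x : ℝ} (hx : x ∈ Icc (-1 : ℝ) 1) :
    IntervalIntegrable (fun s => N x s * v s) volume (-1) x := by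
  refine (hN.intervalIntegrable_mul hv hx).mono_set ?_
  rw [uIcc_of_le hx.1, uIcc_of_le (by norm_num)]
  exact Icc_subset_Icc_right hx.2

/-- The upper limit `y` is independent of `x`, so that one bound covers the Volterra part (`y = x`)
and the full integral (`y = 1`). -/
theorem abs_integral_le {M : ℝ} (hM : ∀ x ∈ Icc (-1 : ℝ) 1, ∀ s ∈ Icc (-1 : ℝ) 1, |N x s| ≤ M)
    {v : ℝ → ℝ} (hv : IntervalIntegrable v volume (-1) 1) {x y : ℝ} (hx : x ∈ Icc (-1 : ℝ) 1)
    (hy : y ∈ Icc (-1 : ℝ) 1) :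
    |∫ s in (-1)..y, N x s * v s| ≤ M * ∫ s in (-1)..1, |v s| := by
  have hM0 : 0 ≤ M := (abs_nonneg _).trans (hM x hx x hx)
  have hsub : uIcc (-1) y ⊆ uIcc (-1 : ℝ) 1 := by
    rw [uIcc_of_le hy.1, uIcc_of_le (by norm_num)]; exact Icc_subset_Icc_right hy.2
  calc |∫ s in (-1)..y, N x s * v s| ≤ ∫ s in (-1)..y, M * |v s| := by
        rw [← Real.norm_eq_abs]
        refine intervalIntegral.norm_integral_le_of_norm_le hy.1 (ae_of_all _ fun s hs => ?_)
          ((hv.mono_set hsub).abs.const_mul M)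
        rw [Real.norm_eq_abs, abs_mul]
        exact mul_le_mul_of_nonneg_right (hM x hx s ⟨hs.1.le, hs.2.trans hy.2⟩) (abs_nonneg _)
    _ = M * ∫ s in (-1)..y, |v s| := intervalIntegral.integral_const_mul _ _
    _ ≤ M * ∫ s in (-1)..1, |v s| := by
        gcongr
        exact intervalIntegral.integral_mono_interval le_rfl hy.1 hy.2
          (ae_of_all _ fun s => abs_nonneg _) hv.abs

/-- The variable upper limit becomes the indicator of a measurable set in the plane, and
measurability of parametric integrals applies. -/
theorem stronglyMeasurable_integral (hN : BoundedKernel N) {v : ℝ → ℝ} (hv : StronglyMeasurable v) :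
    StronglyMeasurable fun x => ∫ s in Ioc (-1) x, N x s * v s := by
  have hs : MeasurableSet {q : ℝ × ℝ | -1 < q.2 ∧ q.2 ≤ q.1} :=
    (measurableSet_lt measurable_const measurable_snd).inter
      (measurableSet_le measurable_snd measurable_fst)
  have hm : StronglyMeasurable ({q : ℝ × ℝ | -1 < q.2 ∧ q.2 ≤ q.1}.indicator
      fun q => N q.1 q.2 * v q.2) :=
    ((hN.measurable.mul (hv.measurable.comp measurable_snd)).indicator hs).stronglyMeasurable
  have := hm.integral_prod_right' (ν := volume)
  convert this using 2 with x
  rw [← integral_indicator measurableSet_Ioc]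
  refine integral_congr_ae (ae_of_all _ fun s => ?_)
  by_cases h : -1 < s ∧ s ≤ x
  · simp [indicator, h]
  · have h' : s ∉ Ioc (-1) x := h
    simp only [indicator, h', if_false]
    exact (if_neg h).symm

theorem stronglyMeasurable_integral_full (hN : BoundedKernel N) {v : ℝ → ℝ}
    (hv : StronglyMeasurable v) : StronglyMeasurable fun x => ∫ s in (-1)..1, N x s * v s := by
  simp only [intervalIntegral.integral_of_le (show (-1 : ℝ) ≤ 1 by norm_num)]
  exact StronglyMeasurable.integral_prod_right'
    (hN.measurable.mul (hv.measurable.comp measurable_snd)).stronglyMeasurable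

end BoundedKernel

theorem intervalIntegrable_coeFn (U : Lp ℝ 2 measureT) : IntervalIntegrable U volume (-1) 1 :=
  intervalIntegrable_of_memLp (memLp_restrict_of_memLp_measureT (Lp.memLp U))

/-- `w ≥ 1`, then Cauchy–Schwarz against the constant `1`. -/
theorem integral_abs_le (U : Lp ℝ 2 measureT) :
    ∫ s in (-1)..1, |U s| ≤ ‖polyLp 1‖ * ‖U‖ := by
  have h1 : ∫ s, |U s| ∂measureT = inner ℝ |U| (polyLp 1) := by
    rw [← chebInner_eq_inner (Lp.coeFn_abs U).symm (coeFn_polyLp 1)]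
    simp [chebInner]
  have h2 : ∫ s in (-1)..1, |U s| ≤ ∫ s, |U s| ∂measureT := by
    rw [intervalIntegral.integral_of_le (by norm_num), ← integral_Icc_eq_integral_Ioc]
    exact integral_mono_measure restrict_Icc_le_measureT (ae_of_all _ fun _ => abs_nonneg _)
      ((Lp.memLp U).integrable one_le_two).abs
  refine h2.trans (h1.le.trans ((real_inner_le_norm _ _).trans ?_))
  rw [norm_abs_eq_norm, mul_comm]

section threePI

variable {N₀ : ℝ → ℝ} {N₁ N₂ : ℝ → ℝ → ℝ}

theorem threePI_congr {v w : ℝ → ℝ} (h : v =ᵐ[measureT] w) :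
    threePI N₀ N₁ N₂ v =ᵐ[measureT] threePI N₀ N₁ N₂ w := by
  have h' := (ae_restrict_iff' measurableSet_Icc).1 (ae_measureT_iff.1 h)
  filter_upwards [h, ae_measureT_mem_Icc] with x hx hx2
  rw [threePI, threePI, hx]
  congr 1
  · congr 1
    refine intervalIntegral.integral_congr_ae ?_
    filter_upwards [h'] with s hs hs2
    rw [uIoc_of_le hx2.1] at hs2
    rw [hs ⟨hs2.1.le, hs2.2.trans hx2.2⟩]
  · refine intervalIntegral.integral_congr_ae ?_
    filter_upwards [h'] with s hs hs2
    rw [uIoc_of_le (by norm_num)] at hs2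
    rw [hs ⟨hs2.1.le, hs2.2⟩]

theorem threePI_smul_add (h₁ : BoundedKernel N₁) (h₂ : BoundedKernel N₂) {v w : ℝ → ℝ}
    (hv : IntervalIntegrable v volume (-1) 1) (hw : IntervalIntegrable w volume (-1) 1) (c : ℝ)
    {x : ℝ} (hx : x ∈ Icc (-1 : ℝ) 1) :
    threePI N₀ N₁ N₂ (fun s => c * v s + w s) x =
      c * threePI N₀ N₁ N₂ v x + threePI N₀ N₁ N₂ w x := by
  have e : ∀ N : ℝ → ℝ → ℝ, ∀ s, N x s * (c * v s + w s) = c * (N x s * v s) + N x s * w s :=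
    fun N s => by ring
  simp only [threePI, e]
  rw [intervalIntegral.integral_add ((h₁.intervalIntegrable_mul_left hv hx).const_mul c)
      (h₁.intervalIntegrable_mul_left hw hx),
    intervalIntegral.integral_add ((h₂.intervalIntegrable_mul hv hx).const_mul c)
      (h₂.intervalIntegrable_mul hw hx), intervalIntegral.integral_const_mul,
    intervalIntegral.integral_const_mul]
  ring

theorem exists_abs_threePI_le (h₀ : BoundedKernel fun x _ => N₀ x) (h₁ : BoundedKernel N₁)
    (h₂ : BoundedKernel N₂) : ∃ M, 0 ≤ M ∧ ∀ v : ℝ → ℝ, IntervalIntegrable v volume (-1) 1 →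
      ∀ x ∈ Icc (-1 : ℝ) 1,
      |threePI N₀ N₁ N₂ v x| ≤ M * |v x| + M * ∫ s in (-1)..1, |v s| := by
  obtain ⟨M₀, hM₀⟩ := h₀.bounded
  obtain ⟨M₁, hM₁⟩ := h₁.bounded
  obtain ⟨M₂, hM₂⟩ := h₂.bounded
  have z : (0 : ℝ) ∈ Icc (-1 : ℝ) 1 := by norm_num
  have n₀ : 0 ≤ M₀ := (abs_nonneg _).trans (hM₀ 0 z 0 z)
  have n₁ : 0 ≤ M₁ := (abs_nonneg _).trans (hM₁ 0 z 0 z)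
  have n₂ : 0 ≤ M₂ := (abs_nonneg _).trans (hM₂ 0 z 0 z)
  refine ⟨M₀ + M₁ + M₂, by positivity, fun v hv x hx => ?_⟩
  have b₁ := BoundedKernel.abs_integral_le hM₁ hv hx hx
  have b₂ := BoundedKernel.abs_integral_le hM₂ hv hx (right_mem_Icc.2 (by norm_num))
  have b₀ : |N₀ x * v x| ≤ M₀ * |v x| := by
    rw [abs_mul]; exact mul_le_mul_of_nonneg_right (hM₀ x hx x hx) (abs_nonneg _)
  have hI : 0 ≤ ∫ s in (-1)..1, |v s| :=
    intervalIntegral.integral_nonneg (by norm_num) fun _ _ => abs_nonneg _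
  have hv0 := abs_nonneg (v x)
  rw [threePI]
  refine (abs_add_le _ _).trans ((add_le_add_left (abs_add_le _ _) _).trans ?_)
  nlinarith [mul_nonneg n₁ hv0, mul_nonneg n₂ hv0, mul_nonneg n₀ hI]

theorem memLp_threePI (h₀ : BoundedKernel fun x _ => N₀ x) (h₁ : BoundedKernel N₁)
    (h₂ : BoundedKernel N₂) (U : Lp ℝ 2 measureT) : MemLp (threePI N₀ N₁ N₂ U) 2 measureT := by
  obtain ⟨M, hM, hb⟩ := exists_abs_threePI_le h₀ h₁ h₂
  have hU := Lp.stronglyMeasurable U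
  have hm : AEStronglyMeasurable (threePI N₀ N₁ N₂ U) measureT := by
    have hN0 : Measurable N₀ :=
      h₀.measurable.comp (measurable_id.prodMk measurable_const : Measurable fun x : ℝ => (x, (0 : ℝ)))
    refine AEStronglyMeasurable.congr (((hN0.stronglyMeasurable.mul hU).add
      (h₁.stronglyMeasurable_integral hU)).add
      (h₂.stronglyMeasurable_integral_full hU)).aestronglyMeasurable ?_
    filter_upwards [ae_measureT_mem_Icc] with x hx
    simp only [threePI, Pi.add_apply, Pi.mul_apply, intervalIntegral.integral_of_le hx.1]
  have hg : MemLp (fun x => M * |U x| + M * ∫ s in (-1)..1, |U s|) 2 measureT :=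
    ((Lp.memLp U).abs.const_mul M).add (memLp_const _)
  refine hg.of_le hm (ae_measureT_mem_Icc.mono fun x hx => ?_)
  exact (hb U (intervalIntegrable_coeFn U) x hx).trans (le_abs_self _)

/-- Passage from operators on functions to operators on `L²_w`; afterwards the estimates take place
in the Hilbert space. -/
theorem exists_continuousLinearMap_threePI (h₀ : BoundedKernel fun x _ => N₀ x)
    (h₁ : BoundedKernel N₁) (h₂ : BoundedKernel N₂) :
    ∃ L : Lp ℝ 2 measureT →L[ℝ] Lp ℝ 2 measureT, ∀ (u : ℝ → ℝ) (U : Lp ℝ 2 measureT),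
      u =ᵐ[measureT] U → threePI N₀ N₁ N₂ u =ᵐ[measureT] L U := by
  obtain ⟨M, hM, hb⟩ := exists_abs_threePI_le h₀ h₁ h₂
  have hlin : ∀ (c : ℝ) (U V : Lp ℝ 2 measureT), (memLp_threePI h₀ h₁ h₂ (c • U + V)).toLp =
      c • (memLp_threePI h₀ h₁ h₂ U).toLp + (memLp_threePI h₀ h₁ h₂ V).toLp := by
    intro c U V
    rw [← MemLp.toLp_const_smul, ← MemLp.toLp_add]
    refine (MemLp.toLp_eq_toLp_iff _ _).2 ?_
    have h : (c • U + V : Lp ℝ 2 measureT) =ᵐ[measureT] fun s => c * U s + V s := by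
      filter_upwards [Lp.coeFn_add (c • U) V, Lp.coeFn_smul c U] with x h1 h2
      rw [h1, Pi.add_apply, h2]; simp
    filter_upwards [threePI_congr (N₀ := N₀) (N₁ := N₁) (N₂ := N₂) h, ae_measureT_mem_Icc]
      with x h1 hx
    rw [h1, threePI_smul_add h₁ h₂ (intervalIntegrable_coeFn U) (intervalIntegrable_coeFn V) c hx]
    simp
  let L₀ : Lp ℝ 2 measureT →ₗ[ℝ] Lp ℝ 2 measureT :=
    { toFun := fun U => (memLp_threePI h₀ h₁ h₂ U).toLp
      map_add' := fun U V => by simpa using hlin 1 U V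
      map_smul' := fun c U => by
        -- The case `U = V = 0` shows that zero is mapped to zero.
        have z := hlin 1 0 0
        rw [one_smul, add_zero, one_smul, left_eq_add] at z
        have h := hlin c U 0
        rwa [z, add_zero, add_zero] at h }
  -- One factor `‖1‖` comes from bounding `∫ |U|`, the other from taking the norm of the resulting
  -- constant function.
  have hbd : ∀ U, ‖L₀ U‖ ≤ (M + M * (‖polyLp 1‖ * ‖polyLp 1‖)) * ‖U‖ := by
    intro U
    have h1 : ‖L₀ U‖ ≤ ‖M • |U| + (M * (‖polyLp 1‖ * ‖U‖)) • polyLp 1‖ := by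
      refine Lp.norm_le_norm_of_ae_le ?_
      filter_upwards [MemLp.coeFn_toLp (memLp_threePI h₀ h₁ h₂ U), ae_measureT_mem_Icc,
        Lp.coeFn_add (M • |U|) ((M * (‖polyLp 1‖ * ‖U‖)) • polyLp 1), Lp.coeFn_smul M |U|,
        Lp.coeFn_smul (M * (‖polyLp 1‖ * ‖U‖)) (polyLp 1), Lp.coeFn_abs U, coeFn_polyLp 1]
        with x e1 hx e2 e3 e4 e5 e6
      change ‖((memLp_threePI h₀ h₁ h₂ U).toLp) x‖ ≤ _
      rw [e1, e2, Pi.add_apply, e3, e4, Pi.smul_apply, Pi.smul_apply, e5, ← e6]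
      simp only [smul_eq_mul, Polynomial.eval_one, mul_one, Real.norm_eq_abs]
      refine (hb U (intervalIntegrable_coeFn U) x hx).trans (le_trans ?_ (le_abs_self _))
      gcongr
      exact integral_abs_le U
    refine h1.trans ((norm_add_le _ _).trans ?_)
    rw [norm_smul, norm_smul, norm_abs_eq_norm, Real.norm_of_nonneg hM,
      Real.norm_of_nonneg (by positivity)]
    exact le_of_eq (by ring)
  refine ⟨L₀.mkContinuous _ hbd, fun u U hu => ?_⟩
  exact (threePI_congr hu).trans (MemLp.coeFn_toLp (memLp_threePI h₀ h₁ h₂ U)).symm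

end threePI

/-! ### The operators of the equation: boundedness, derivatives, polynomials -/

theorem continuous_bdryQ (p : ℕ) : Continuous (bdryQ p) := by
  match p with
  | 0 => exact continuous_const
  | 1 => exact continuous_const
  | 2 =>
    refine continuous_pi fun i => ?_
    fin_cases i <;> simp [bdryQ] <;> fun_prop
  | _ + 3 => exact continuous_const

theorem continuous_rowK (p : ℕ) : Continuous (rowK p) := by
  unfold rowK; fun_prop

namespace ScalarPDE

variable {p : ℕ} (P : ScalarPDE p)

theorem continuous_mulVec_bdryQ (j : Fin p) :
    Continuous fun s => ((P.BT⁻¹ * P.B) *ᵥ bdryQ p s) j := by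
  have := continuous_bdryQ p
  unfold Matrix.mulVec dotProduct
  fun_prop

theorem boundedKernel_kerG₂ : BoundedKernel P.kerG₂ := by
  refine BoundedKernel.of_continuous ?_
  have h1 := continuous_rowK p
  have h2 := P.continuous_mulVec_bdryQ
  unfold kerG₂ dotProduct
  simp only [Function.uncurry_def]
  refine (continuous_finsetSum _ fun j _ => ?_).neg
  exact ((continuous_apply j).comp (h1.comp continuous_fst)).mul ((h2 j).comp continuous_snd)

theorem boundedKernel_kerG₅ : BoundedKernel fun _ s => P.kerG₅ s := by
  refine BoundedKernel.of_continuous ?_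
  have h2 := P.continuous_mulVec_bdryQ
  unfold kerG₅ dotProduct
  simp only [Function.uncurry_def]
  refine (continuous_finsetSum _ fun j _ => ?_).neg
  exact continuous_const.mul ((h2 j).comp continuous_snd)

theorem _root_.PIE.boundedKernel_kerG₁ (p : ℕ) : BoundedKernel (kerG₁ p) := by
  refine BoundedKernel.of_continuous ?_
  unfold kerG₁
  simp only [Function.uncurry_def]
  split_ifs <;> fun_prop

theorem exists_continuousLinearMap_opT :
    ∃ L : Lp ℝ 2 measureT →L[ℝ] Lp ℝ 2 measureT, ∀ (u : ℝ → ℝ) (U : Lp ℝ 2 measureT),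
      u =ᵐ[measureT] U → P.opT u =ᵐ[measureT] L U :=
  exists_continuousLinearMap_threePI (BoundedKernel.const _) (boundedKernel_kerG₁ p)
    P.boundedKernel_kerG₂

theorem exists_continuousLinearMap_opA (hP : P.Admissible) :
    ∃ L : Lp ℝ 2 measureT →L[ℝ] Lp ℝ 2 measureT, ∀ (u : ℝ → ℝ) (U : Lp ℝ 2 measureT),
      u =ᵐ[measureT] U → P.opA u =ᵐ[measureT] L U := by
  have b₀ := BoundedKernel.of_left hP.meas₀ hP.bdd₀
  have b₁ := BoundedKernel.of_left hP.meas₁ hP.bdd₁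
  have b₂ := BoundedKernel.of_left hP.meas₂ hP.bdd₂
  refine exists_continuousLinearMap_threePI ?_ ?_ ?_
  · refine ((b₀.mul (.const _)).add (b₁.mul (.const _))).add ?_
    split_ifs
    · exact b₂
    · exact .const 0
  · exact (b₀.mul (boundedKernel_kerG₁ p)).add (b₁.mul (.const _))
  · exact (b₀.mul P.boundedKernel_kerG₂).add (b₁.mul P.boundedKernel_kerG₅)

end ScalarPDE

/-- Cauchy's formula for repeated integration, by parts with `y - x` as primitive of `1`; the
boundary terms vanish at both ends. -/
theorem integral_integral_eq_integral_sub_mul {v : ℝ → ℝ} {x : ℝ}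
    (hv : IntervalIntegrable v volume (-1) x) :
    ∫ y in (-1)..x, ∫ s in (-1)..y, v s = ∫ s in (-1)..x, (x - s) * v s := by
  have hF := hv.absolutelyContinuousOnInterval_intervalIntegral (c := -1) (by simp)
  have hG := (intervalIntegrable_const (c := (1 : ℝ)) (μ := volume) (a := -1)
    (b := x)).absolutelyContinuousOnInterval_intervalIntegral (c := x) (by simp)
  have h := hF.integral_mul_deriv_eq_deriv_mul hG
  simp only [intervalIntegral.integral_const, smul_eq_mul, mul_one, sub_self, mul_zero,
    intervalIntegral.integral_same, zero_mul, zero_sub] at h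
  have hd : ∀ y : ℝ, deriv (fun s : ℝ => s - x) y = 1 := fun y => by simp
  simp only [hd, mul_one] at h
  rw [h, ← intervalIntegral.integral_neg]
  refine intervalIntegral.integral_congr_ae ?_
  filter_upwards [hv.ae_hasDerivAt_integral] with y hy hy2
  rw [(hy (uIoc_subset_uIcc hy2) (-1) (by simp)).deriv]
  ring

theorem hasWeakDeriv_add_integral {v : ℝ → ℝ} (hv : IntervalIntegrable v volume (-1) 1) (c : ℝ) :
    HasWeakDeriv (fun x => (∫ s in (-1)..x, v s) + c) v :=
  ⟨hv, c, ae_of_all _ fun _ => add_comm _ _⟩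

theorem hasWeakDeriv_integral_sub_mul {v : ℝ → ℝ} (hv : IntervalIntegrable v volume (-1) 1)
    (c d : ℝ) : HasWeakDeriv (fun x => (∫ s in (-1)..x, (x - s) * v s) + (c + (x + 1) * d))
      (fun x => (∫ s in (-1)..x, v s) + d) := by
  have hc : ContinuousOn (fun x => ∫ s in (-1)..x, v s) (uIcc (-1) 1) :=
    intervalIntegral.continuousOn_primitive_interval' hv (by simp)
  refine ⟨(hc.add continuousOn_const).intervalIntegrable, c, ?_⟩
  filter_upwards [ae_restrict_mem measurableSet_Icc] with x hx
  have hsub : uIcc (-1) x ⊆ uIcc (-1 : ℝ) 1 := by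
    rw [uIcc_of_le hx.1, uIcc_of_le (by norm_num)]; exact Icc_subset_Icc_right hx.2
  rw [intervalIntegral.integral_add (hc.mono hsub).intervalIntegrable intervalIntegrable_const,
    integral_integral_eq_integral_sub_mul (hv.mono_set hsub), intervalIntegral.integral_const]
  simp only [smul_eq_mul]
  ring

theorem exists_polynomial_integral (n : ℕ) (q : Polynomial ℝ) (hq : q.natDegree ≤ n) :
    ∃ Q : Polynomial ℝ, Q.natDegree ≤ n + 1 ∧ ∀ x, ∫ s in (-1)..x, q.eval s = Q.eval x := by
  set R : Polynomial ℝ := ∑ i ∈ Finset.range (n + 1),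
    Polynomial.C (q.coeff i / (i + 1)) * Polynomial.X ^ (i + 1) with hR
  have hd : R.derivative = q := by
    rw [hR, Polynomial.derivative_sum]
    conv_rhs => rw [q.as_sum_range_C_mul_X_pow' (Nat.lt_succ_of_le hq)]
    refine Finset.sum_congr rfl fun i _ => ?_
    rw [Polynomial.derivative_C_mul_X_pow]
    simp only [Nat.cast_add, Nat.cast_one, Nat.add_sub_cancel]
    rw [div_mul_cancel₀ _ (by positivity)]
  have hdeg : R.natDegree ≤ n + 1 := Polynomial.natDegree_sum_le_of_forall_le _ _ fun i hi =>
    (Polynomial.natDegree_C_mul_X_pow_le _ _).trans (Nat.succ_le_of_lt (Finset.mem_range.1 hi))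
  refine ⟨R - Polynomial.C (R.eval (-1)), ?_, fun x => ?_⟩
  · exact (Polynomial.natDegree_sub_C (p := R) (a := R.eval (-1))).le.trans hdeg
  · rw [← hd, intervalIntegral.integral_eq_sub_of_hasDerivAt (fun y _ => R.hasDerivAt y)
      ((Polynomial.continuous _).intervalIntegrable _ _)]
    simp

theorem exists_polynomial_rowK (p : ℕ) (c : Fin p → ℝ) :
    ∃ Q : Polynomial ℝ, Q.natDegree ≤ p - 1 ∧ ∀ x, rowK p x ⬝ᵥ c = Q.eval x := by
  refine ⟨∑ j : Fin p, Polynomial.C (c j) * (Polynomial.X + Polynomial.C 1) ^ (j : ℕ), ?_,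
    fun x => ?_⟩
  · refine Polynomial.natDegree_sum_le_of_forall_le _ _ fun j _ => ?_
    refine (Polynomial.natDegree_C_mul_le _ _).trans (Polynomial.natDegree_pow_le.trans ?_)
    rw [Polynomial.natDegree_X_add_C]
    have := j.2
    omega
  · rw [Polynomial.eval_finsetSum]
    simp [dotProduct, rowK, mul_comm]

namespace ScalarPDE

variable {p : ℕ} (P : ScalarPDE p)

/-- The kernel is degenerate: `K(x)` factors out. Hence the boundary correction in `𝒯 v` is a
polynomial of degree below `p`, annihilated by `∂_x^p`. -/
theorem exists_integral_kerG₂ {v : ℝ → ℝ} (hv : IntervalIntegrable v volume (-1) 1) :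
    ∃ c : Fin p → ℝ, ∀ x, ∫ s in (-1)..1, P.kerG₂ x s * v s = rowK p x ⬝ᵥ c := by
  refine ⟨fun j => ∫ s in (-1)..1, -(((P.BT⁻¹ * P.B) *ᵥ bdryQ p s) j) * v s, fun x => ?_⟩
  have e : ∀ s, P.kerG₂ x s * v s =
      ∑ j, rowK p x j * (-(((P.BT⁻¹ * P.B) *ᵥ bdryQ p s) j) * v s) := fun s => by
    rw [kerG₂, dotProduct, ← Finset.sum_neg_distrib, Finset.sum_mul]
    exact Finset.sum_congr rfl fun j _ => by ring
  simp only [e]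
  rw [intervalIntegral.integral_finsetSum fun j _ => ?_]
  · simp only [intervalIntegral.integral_const_mul, dotProduct]
  · exact (hv.continuousOn_mul (P.continuous_mulVec_bdryQ j).neg.continuousOn).const_mul _

theorem exists_opT_eq {v : ℝ → ℝ} (hv : IntervalIntegrable v volume (-1) 1) :
    ∃ c : Fin p → ℝ, ∀ x, P.opT v x =
      kerG₀ p * v x + (∫ s in (-1)..x, kerG₁ p x s * v s) + rowK p x ⬝ᵥ c := by
  obtain ⟨c, hc⟩ := P.exists_integral_kerG₂ hv
  exact ⟨c, fun x => by rw [opT, threePI, hc]⟩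

theorem exists_primary_eq (h : Fin p → ℝ) {v : ℝ → ℝ} (hv : IntervalIntegrable v volume (-1) 1) :
    ∃ c : Fin p → ℝ, ∀ x, P.primary h v x =
      kerG₀ p * v x + (∫ s in (-1)..x, kerG₁ p x s * v s) + rowK p x ⬝ᵥ c := by
  obtain ⟨c, hc⟩ := P.exists_opT_eq hv
  refine ⟨P.BT⁻¹ *ᵥ h + c, fun x => ?_⟩
  rw [primary, hc, dotProduct_add]
  ring

/-- The fundamental state is the weak derivative of order `p` of the primary state. -/
theorem memH_of_primary (hp : p ≤ 2) {m : ℕ} (hm : p ≤ m) {h : Fin p → ℝ} {v : ℝ → ℝ}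
    (hv : IntervalIntegrable v volume (-1) 1) (hH : MemH m (P.primary h v)) : MemH (m - p) v := by
  obtain ⟨c, hc⟩ := P.exists_primary_eq h hv
  rw [funext hc] at hH
  interval_cases p
  · refine hH.congr (ae_of_all _ fun x => ?_)
    simp [kerG₀, kerG₁]
  · obtain ⟨k, rfl⟩ : ∃ k, m = k + 1 := ⟨m - 1, by omega⟩
    refine MemH.of_hasWeakDeriv hH ((hasWeakDeriv_add_integral hv (c 0)).congr
      (ae_of_all _ fun x => ?_) (ae_of_all _ fun _ => rfl))
    simp [kerG₀, kerG₁, rowK, dotProduct]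
  · obtain ⟨k, rfl⟩ : ∃ k, m = k + 1 + 1 := ⟨m - 2, by omega⟩
    refine MemH.of_hasWeakDeriv (MemH.of_hasWeakDeriv hH
      ((hasWeakDeriv_integral_sub_mul hv (c 0) (c 1)).congr
      (ae_of_all _ fun x => ?_) (ae_of_all _ fun _ => rfl))) (hasWeakDeriv_add_integral hv _)
    simp [kerG₀, kerG₁, rowK, dotProduct]

/-- Each of the `p` integrations raises the degree by one. For `p = 2` the kernel is split as `x ∫ q
- ∫ s q`. -/
theorem exists_polynomial_opT (hp : p ≤ 2) {n : ℕ} {q : Polynomial ℝ} (hq : q.natDegree ≤ n) :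
    ∃ Q : Polynomial ℝ, Q.natDegree ≤ n + p ∧ ∀ x, P.opT (fun s => q.eval s) x = Q.eval x := by
  obtain ⟨c, hc⟩ := P.exists_opT_eq ((Polynomial.continuous q).intervalIntegrable (-1) 1)
  obtain ⟨K, hK, hK2⟩ := exists_polynomial_rowK p c
  have key : ∃ Q : Polynomial ℝ, Q.natDegree ≤ n + p ∧ ∀ x, kerG₀ p * q.eval x +
      (∫ s in (-1)..x, kerG₁ p x s * q.eval s) = Q.eval x := by
    interval_cases p
    · exact ⟨q, hq, fun x => by simp [kerG₀, kerG₁]⟩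
    · obtain ⟨Q, hQ, h⟩ := exists_polynomial_integral n q hq
      exact ⟨Q, hQ, fun x => by simp [kerG₀, kerG₁, h]⟩
    · obtain ⟨Q, hQ, h⟩ := exists_polynomial_integral n q hq
      obtain ⟨Q', hQ', h'⟩ := exists_polynomial_integral (n + 1) (Polynomial.X * q)
        (Polynomial.natDegree_mul_le.trans (by rw [Polynomial.natDegree_X]; omega))
      refine ⟨Polynomial.X * Q - Q', ?_, fun x => ?_⟩
      · refine (Polynomial.natDegree_sub_le _ _).trans (max_le ?_ hQ')
        exact Polynomial.natDegree_mul_le.trans (by rw [Polynomial.natDegree_X]; omega)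
      · simp only [kerG₀, kerG₁, Polynomial.eval_sub, Polynomial.eval_mul, Polynomial.eval_X, ← h,
          ← h']
        rw [← intervalIntegral.integral_const_mul, ← intervalIntegral.integral_sub]
        · simp [sub_mul]
        · exact (by fun_prop : Continuous _).intervalIntegrable _ _
        · exact (by fun_prop : Continuous _).intervalIntegrable _ _
  obtain ⟨Q, hQ, hQ2⟩ := key
  refine ⟨Q + K, Polynomial.natDegree_add_le_of_degree_le hQ (hK.trans (by omega)), fun x => ?_⟩
  rw [hc, hQ2, hK2, Polynomial.eval_add]

theorem opT_mem_polySpace (hp : p ≤ 2) {L : Lp ℝ 2 measureT →L[ℝ] Lp ℝ 2 measureT}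
    (hL : ∀ (u : ℝ → ℝ) (U : Lp ℝ 2 measureT), u =ᵐ[measureT] U → P.opT u =ᵐ[measureT] L U)
    {n : ℕ} {U : Lp ℝ 2 measureT} (hU : U ∈ polySpace n) : L U ∈ polySpace (n + p) := by
  obtain ⟨q, hq, rfl⟩ := mem_polySpace_iff.1 hU
  obtain ⟨Q, hQ, h⟩ := P.exists_polynomial_opT hp hq
  have : L (polyLp q) = polyLp Q := by
    refine Lp.ext ?_
    filter_upwards [hL _ _ (coeFn_polyLp q), coeFn_polyLp Q] with x h1 h2
    rw [← h1, ← h2, h]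
  rw [this]
  exact polyLp_mem_polySpace hQ

/-- For `n = l + p` the image of the projection of `U` onto degree `l` is a competitor of degree at
most `n`, and `l + p + 1 ≤ (p + 1)(l + 1)`. For `n < p` boundedness of `L` is enough; the summand
`1` in the constant covers that case. -/
theorem exists_norm_opT_sub_starProjection_le (hp : p ≤ 2)
    {L : Lp ℝ 2 measureT →L[ℝ] Lp ℝ 2 measureT}
    (hL : ∀ (u : ℝ → ℝ) (U : Lp ℝ 2 measureT), u =ᵐ[measureT] U → P.opT u =ᵐ[measureT] L U)
    (k : ℕ) : ∃ C : ℝ, 0 ≤ C ∧ ∀ U : Lp ℝ 2 measureT, MemH k U → ∀ n : ℕ,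
      ((n : ℝ) + 1) ^ k * ‖L U - (polySpace n).starProjection (L U)‖ ≤ C * sobolevNorm k U := by
  refine ⟨((p : ℝ) + 1) ^ k * ‖L‖ * ((k : ℝ) ^ k + 1), by positivity, fun U hU n => ?_⟩
  have hs := sobolevNorm_nonneg k U
  rcases lt_or_ge n p with h | h
  · have h1 : ‖L U - (polySpace n).starProjection (L U)‖ ≤ ‖L‖ * sobolevNorm k U :=
      (norm_sub_starProjection_le_norm _ _).trans ((L.le_opNorm U).trans (by
        gcongr; exact norm_le_sobolevNorm k U))
    have h2 : ((n : ℝ) + 1) ^ k ≤ ((p : ℝ) + 1) ^ k := by gcongr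
    calc _ ≤ ((p : ℝ) + 1) ^ k * (‖L‖ * sobolevNorm k U) := by gcongr
      _ = ((p : ℝ) + 1) ^ k * ‖L‖ * 1 * sobolevNorm k U := by ring
      _ ≤ _ := by
        gcongr
        exact le_add_of_nonneg_left (by positivity)
  · obtain ⟨l, rfl⟩ : ∃ l, n = l + p := ⟨n - p, by omega⟩
    have h1 : ‖L U - (polySpace (l + p)).starProjection (L U)‖ ≤
        ‖L‖ * ‖U - (polySpace l).starProjection U‖ := by
      refine (norm_sub_starProjection_le _ _ (P.opT_mem_polySpace hp hL
        ((polySpace l).starProjection_apply_mem U))).trans ?_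
      rw [← map_sub]
      exact L.le_opNorm _
    have h2 : (((l + p : ℕ) : ℝ) + 1) ^ k ≤ ((p : ℝ) + 1) ^ k * ((l : ℝ) + 1) ^ k := by
      rw [← mul_pow]
      gcongr
      push_cast
      nlinarith [mul_nonneg (Nat.cast_nonneg (α := ℝ) p) (Nat.cast_nonneg (α := ℝ) l)]
    have h3 := norm_sub_starProjection_le_sobolevNorm hU l
    calc _ ≤ ((p : ℝ) + 1) ^ k * ((l : ℝ) + 1) ^ k *
          (‖L‖ * ‖U - (polySpace l).starProjection U‖) := by gcongr
      _ = ((p : ℝ) + 1) ^ k * ‖L‖ *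
          (((l : ℝ) + 1) ^ k * ‖U - (polySpace l).starProjection U‖) := by ring
      _ ≤ ((p : ℝ) + 1) ^ k * ‖L‖ * ((k : ℝ) ^ k * sobolevNorm k U) := by gcongr
      _ = ((p : ℝ) + 1) ^ k * ‖L‖ * (k : ℝ) ^ k * sobolevNorm k U := by ring
      _ ≤ _ := by
        gcongr
        exact le_add_of_nonneg_right zero_le_one

end ScalarPDE

/-! ### Energy estimate and error equation -/

/-- Grönwall's inequality for a dissipative evolution in a Hilbert space. -/
theorem norm_sq_le_exp_mul_integral {E : Type*} [NormedAddCommGroup E] [InnerProductSpace ℝ E]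
    {e e' r : ℝ → E} {φ : ℝ → ℝ} {t : ℝ} (ht : 0 ≤ t)
    (he : ∀ s, 0 ≤ s → HasDerivWithinAt e (e' s) (Ici 0) s) (h0 : e 0 = 0)
    (hr : ∀ s, 0 ≤ s → inner ℝ (e' s) (e s) ≤ inner ℝ (r s) (e s))
    (hφ : ∀ s, 0 ≤ s → ‖r s‖ ^ 2 ≤ φ s) (hφi : IntervalIntegrable φ volume 0 t) :
    ‖e t‖ ^ 2 ≤ Real.exp t * ∫ s in (0 : ℝ)..t, φ s := by
  have hd : ∀ s, 0 ≤ s → HasDerivWithinAt (fun s => Real.exp (-s) * ‖e s‖ ^ 2)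
      (-Real.exp (-s) * ‖e s‖ ^ 2 + Real.exp (-s) * (2 * inner ℝ (e s) (e' s))) (Ici 0) s := by
    intro s hs
    have h1 : HasDerivWithinAt (fun s : ℝ => Real.exp (-s)) (-Real.exp (-s)) (Ici 0) s := by
      simpa using ((hasDerivAt_neg s).exp).hasDerivWithinAt
    exact h1.mul (he s hs).norm_sq
  -- The derivative of `exp(-s) ‖e‖²` is at most `φ`, by `2 (r, e) ≤ ‖r‖² + ‖e‖²`. This form of the
  -- fundamental theorem needs integrability of the upper bound only, not of the derivative.
  have key := intervalIntegral.sub_le_integral_of_hasDeriv_right_of_le ht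
    (g := fun s => Real.exp (-s) * ‖e s‖ ^ 2) (φ := φ)
    (fun s hs => (hd s hs.1).continuousWithinAt.mono Icc_subset_Ici_self)
    (fun s hs => (hd s hs.1.le).mono fun y hy => (hs.1.trans hy).le)
    ((intervalIntegrable_iff_integrableOn_Icc_of_le ht).1 hφi)
    (fun s hs => by
      have h1 := hr s hs.1.le
      have h2 := hφ s hs.1.le
      have h3 := real_inner_le_norm (r s) (e s)
      have h4 : Real.exp (-s) ≤ 1 := Real.exp_le_one_iff.2 (by linarith [hs.1])
      have h5 := Real.exp_pos (-s)
      rw [real_inner_comm] at h1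
      have h6 : 2 * inner ℝ (e s) (e' s) - ‖e s‖ ^ 2 ≤ φ s := by
        nlinarith [sq_nonneg (‖r s‖ - ‖e s‖)]
      have h7 : 0 ≤ φ s := (sq_nonneg _).trans h2
      calc _ = Real.exp (-s) * (2 * inner ℝ (e s) (e' s) - ‖e s‖ ^ 2) := by ring
        _ ≤ Real.exp (-s) * φ s := by gcongr
        _ ≤ φ s := mul_le_of_le_one_left h7 h4)
  simp only [h0, norm_zero, ne_eq, OfNat.ofNat_ne_zero, not_false_eq_true, zero_pow, mul_zero,
    sub_zero] at key
  calc ‖e t‖ ^ 2 = Real.exp t * (Real.exp (-t) * ‖e t‖ ^ 2) := by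
        rw [← mul_assoc, ← Real.exp_add]; simp
    _ ≤ _ := by gcongr

namespace ScalarPDE

variable {p : ℕ} {P : ScalarPDE p}

section abstract_relations

variable {T A : Lp ℝ 2 measureT →L[ℝ] Lp ℝ 2 measureT}
  (hT : ∀ (u : ℝ → ℝ) (U : Lp ℝ 2 measureT), u =ᵐ[measureT] U → P.opT u =ᵐ[measureT] T U)
  (hA : ∀ (u : ℝ → ℝ) (U : Lp ℝ 2 measureT), u =ᵐ[measureT] U → P.opA u =ᵐ[measureT] A U)
  {h h' : ℝ → Fin p → ℝ} {f : ℝ → ℝ → ℝ} {uf uf' : ℝ → Lp ℝ 2 measureT}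
include hT hA

theorem DiscreteNonpos.inner_le_zero (hneg : P.DiscreteNonpos) {n : ℕ} (hn : 0 < n)
    {U : Lp ℝ 2 measureT} (hU : U ∈ polySpace n) :
    inner ℝ ((polySpace n).starProjection (A U)) ((polySpace n).starProjection (T U)) ≤ 0 := by
  obtain ⟨q, hq, rfl⟩ := mem_polySpace_iff.1 hU
  have := hneg n hn q hq
  rwa [chebInner_eq_inner (chebProj_ae_eq (hA _ _ (coeFn_polyLp q)) n)
    (chebProj_ae_eq (hT _ _ (coeFn_polyLp q)) n)] at this

/-- The equation itself places the source in `L²_w`, without any assumption on `f` alone. -/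
theorem IsPIESolution.lumped_ae_eq (hu : P.IsPIESolution h h' f uf uf') {t : ℝ} (ht : 0 ≤ t) :
    P.lumped (h t) (h' t) (f t) =ᵐ[measureT] (T (uf' t) - A (uf t) : Lp ℝ 2 measureT) := by
  filter_upwards [hu.eqn t ht, hT _ _ (Filter.EventuallyEq.refl _ (uf' t)),
    hA _ _ (Filter.EventuallyEq.refl _ (uf t)), Lp.coeFn_sub (T (uf' t)) (A (uf t))]
    with x h1 h2 h3 h4
  rw [h4, Pi.sub_apply, ← h2, ← h3, h1]
  ring

/-- Orthogonality of the residual to all test polynomials means that its projection is zero;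
idempotence removes the second projection of the source. -/
theorem IsGalerkinSolution.starProjection_eq (hu : P.IsPIESolution h h' f uf uf') {n : ℕ}
    {u0 : ℝ → ℝ} {a a' : ℝ → ℕ → ℝ} (ha : P.IsGalerkinSolution n h h' f u0 a a') {t : ℝ}
    (ht : 0 ≤ t) :
    (polySpace n).starProjection (T (polyLp (chebPoly (Finset.range (n + 1)) (a' t)))) =
      (polySpace n).starProjection (A (polyLp (chebPoly (Finset.range (n + 1)) (a t)))) +
        (polySpace n).starProjection (T (uf' t) - A (uf t)) := by
  set R := (polySpace n).starProjection with hR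
  set W := T (polyLp (chebPoly (Finset.range (n + 1)) (a' t))) with hW
  set V := A (polyLp (chebPoly (Finset.range (n + 1)) (a t))) with hV
  set G := T (uf' t) - A (uf t) with hG
  have hRG : R (R G) = R G := Submodule.starProjection_eq_self_iff.2
    ((polySpace n).starProjection_apply_mem G)
  have hz : R (W - (V + R G)) = 0 := by
    refine Submodule.eq_starProjection_of_mem_of_inner_eq_zero (Submodule.zero_mem _) ?_
    intro Q hQ
    obtain ⟨q, hq, rfl⟩ := mem_polySpace_iff.1 hQ
    have hw := ha.weak t ht q hq
    rw [sub_zero, inner_sub_left, sub_eq_zero]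
    have e1 : P.opT (chebSum n (a' t)) =ᵐ[measureT] W := by
      rw [chebSum_eq_eval]; exact hT _ _ (coeFn_polyLp _)
    have e2 : (fun x => P.opA (chebSum n (a t)) x +
        chebProj n (P.lumped (h t) (h' t) (f t)) x) =ᵐ[measureT]
          (V + R G : Lp ℝ 2 measureT) := by
      have e3 : P.opA (chebSum n (a t)) =ᵐ[measureT] V := by
        rw [chebSum_eq_eval]; exact hA _ _ (coeFn_polyLp _)
      filter_upwards [e3, chebProj_ae_eq (hu.lumped_ae_eq hT hA ht) n, Lp.coeFn_add V (R G)]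
        with x h1 h2 h3
      rw [h3, Pi.add_apply, h1, h2]
    rwa [chebInner_eq_inner e1 (coeFn_polyLp q), chebInner_eq_inner e2 (coeFn_polyLp q)] at hw
  rw [map_sub, map_add, hRG, sub_eq_zero] at hz
  exact hz

end abstract_relations

theorem IsGalerkinSolution.hasDerivWithinAt {h h' : ℝ → Fin p → ℝ} {f : ℝ → ℝ → ℝ} {n : ℕ}
    {u0 : ℝ → ℝ} {a a' : ℝ → ℕ → ℝ} (ha : P.IsGalerkinSolution n h h' f u0 a a') {t : ℝ}
    (ht : 0 ≤ t) :
    HasDerivWithinAt (fun s => polyLp (chebPoly (Finset.range (n + 1)) (a s)))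
      (polyLp (chebPoly (Finset.range (n + 1)) (a' t))) (Ici 0) t := by
  simp only [chebPoly, map_sum, map_smul]
  refine HasDerivWithinAt.fun_sum fun k hk => ?_
  exact (ha.deriv k (Nat.lt_succ_iff.1 (Finset.mem_range.1 hk)) t ht).smul_const _

/-- The boundary polynomial has degree at most `p - 1 ≤ 1 ≤ n`, so the projection fixes it and it
cancels in the difference. -/
theorem primaryError_eq_norm {T : Lp ℝ 2 measureT →L[ℝ] Lp ℝ 2 measureT}
    (hT : ∀ (u : ℝ → ℝ) (U : Lp ℝ 2 measureT), u =ᵐ[measureT] U → P.opT u =ᵐ[measureT] T U)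
    (hp : p ≤ 2) {n : ℕ} (hn : 0 < n) (h : Fin p → ℝ) (U : Lp ℝ 2 measureT) (a : ℕ → ℝ) :
    P.primaryError n h U a = ‖T U - (polySpace n).starProjection
      (T (polyLp (chebPoly (Finset.range (n + 1)) a)))‖ := by
  obtain ⟨K, hK, hK2⟩ := exists_polynomial_rowK p (P.BT⁻¹ *ᵥ h)
  have hKmem : polyLp K ∈ polySpace n := polyLp_mem_polySpace (hK.trans (by omega))
  have hprim : ∀ (v : ℝ → ℝ) (V : Lp ℝ 2 measureT), v =ᵐ[measureT] V →
      P.primary h v =ᵐ[measureT] (polyLp K + T V : Lp ℝ 2 measureT) := by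
    intro v V hv
    filter_upwards [hT v V hv, coeFn_polyLp K, Lp.coeFn_add (polyLp K) (T V)] with x h1 h2 h3
    rw [h3, Pi.add_apply, ← h2, ← h1, primary, hK2]
  have h1 := hprim U U (Filter.EventuallyEq.refl _ _)
  have h2 := chebProj_ae_eq (hprim _ _ (coeFn_polyLp (chebPoly (Finset.range (n + 1)) a))) n
  rw [map_add, Submodule.starProjection_eq_self_iff.2 hKmem] at h2
  set S := polyLp (chebPoly (Finset.range (n + 1)) a)
  rw [primaryError]
  have h3 : (fun x => P.primary h U x - chebProj n (P.primary h (chebSum n a)) x) =ᵐ[measureT]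
      (T U - (polySpace n).starProjection (T S) : Lp ℝ 2 measureT) := by
    rw [chebSum_eq_eval]
    have e : T U - (polySpace n).starProjection (T S) =
      (polyLp K + T U) - (polyLp K + (polySpace n).starProjection (T S)) := by abel
    rw [e]
    filter_upwards [h1, h2, Lp.coeFn_sub (polyLp K + T U)
      (polyLp K + (polySpace n).starProjection (T S))] with x e1 e2 e3
    rw [e3, Pi.sub_apply, e1, e2]
  exact chebNorm_eq_norm h3

/-- The error estimate with the Sobolev index `k = m - p` of the fundamental state. -/
theorem exists_primaryError_le (hp : p ≤ 2) (hP : P.Admissible) (hneg : P.DiscreteNonpos) (k : ℕ) :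
    ∃ C : ℝ, ∀ (h h' : ℝ → Fin p → ℝ) (f : ℝ → ℝ → ℝ) (uf uf' : ℝ → Lp ℝ 2 measureT),
      P.IsPIESolution h h' f uf uf' →
      (∀ t, 0 ≤ t → MemH k (uf t)) → (∀ t, 0 ≤ t → MemH k (uf' t)) →
      (∀ t, 0 ≤ t → IntervalIntegrable (fun s => sobolevSq k (uf s)) volume 0 t) →
      (∀ t, 0 ≤ t → IntervalIntegrable (fun s => sobolevSq k (uf' s)) volume 0 t) →
      (∀ t, 0 ≤ t →
        IntervalIntegrable (fun s => chebNorm (P.lumped (h s) (h' s) (f s)) ^ 2) volume 0 t) →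
      ∀ (n : ℕ) (a a' : ℝ → ℕ → ℝ), 0 < n → P.IsGalerkinSolution n h h' f (uf 0) a a' →
        ∀ t : ℝ, 0 ≤ t → P.primaryError n (h t) (uf t) (a t) ≤
          C * ((n : ℝ) ^ k)⁻¹ * (sobolevNorm k (uf t) + Real.exp (t / 2) *
            √(∫ s in (0 : ℝ)..t, (sobolevNorm k (uf' s) ^ 2 + sobolevNorm k (uf s) ^ 2 +
              chebNorm (P.lumped (h s) (h' s) (f s)) ^ 2))) := by
  obtain ⟨T, hT⟩ := P.exists_continuousLinearMap_opT
  obtain ⟨A, hA⟩ := P.exists_continuousLinearMap_opA hP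
  obtain ⟨C₁, hC₁, happ⟩ := P.exists_norm_opT_sub_starProjection_le hp hT k
  set M : ℝ := (‖T‖ + ‖A‖) * (k : ℝ) ^ k with hM
  have hM0 : 0 ≤ M := by positivity
  -- `C₁` pays for projecting `𝒯 u_f`, one `M` for `R 𝒯 (u_f - R u_f)`, and `2 M` for the Grönwall
  -- term.
  refine ⟨C₁ + 2 * M, ?_⟩
  intro h h' f uf uf' hu hmem hmem' hi hi' hig n a a' hn ha t ht
  rw [primaryError_eq_norm hT hp hn]
  set R := (polySpace n).starProjection with hR
  set S : ℝ → Lp ℝ 2 measureT := fun s => polyLp (chebPoly (Finset.range (n + 1)) (a s)) with hS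
  set S' : ℝ → Lp ℝ 2 measureT := fun s => polyLp (chebPoly (Finset.range (n + 1)) (a' s)) with hS'
  have hRle : ∀ U, ‖R U‖ ≤ ‖U‖ := fun U => Submodule.norm_starProjection_apply_le _ _
  have hSmem : ∀ s, S s ∈ polySpace n := fun s =>
    polyLp_mem_polySpace (natDegree_chebPoly_le n _)
  have hRS : ∀ s, R (S s) = S s := fun s => Submodule.starProjection_eq_self_iff.2 (hSmem s)
  set b : ℝ := ((n : ℝ) ^ k)⁻¹ with hb
  have hn1 : (1 : ℝ) ≤ n := by exact_mod_cast hn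
  have hnk : (0 : ℝ) < (n : ℝ) ^ k := by positivity
  have hb0 : 0 ≤ b := by positivity
  have hscale : ∀ x y : ℝ, 0 ≤ x → ((n : ℝ) + 1) ^ k * x ≤ y → x ≤ b * y := by
    intro x y hx hxy
    rw [hb, inv_mul_eq_div, le_div_iff₀ hnk, mul_comm]
    refine le_trans ?_ hxy
    gcongr
    linarith
  have happ0 : ∀ U : Lp ℝ 2 measureT, MemH k U →
      ‖U - R U‖ ≤ b * ((k : ℝ) ^ k * sobolevNorm k U) := fun U hU =>
    hscale _ _ (norm_nonneg _) (norm_sub_starProjection_le_sobolevNorm hU n)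
  have happ1 : ‖T (uf t) - R (T (uf t))‖ ≤ b * (C₁ * sobolevNorm k (uf t)) :=
    hscale _ _ (norm_nonneg _) (happ _ (hmem t ht) n)
  -- The non-positivity pairs `R 𝒜 q` with `R 𝒯 q`, so the energy is measured on `R 𝒯 q` rather than
  -- on `q = R u_f - û_f`.
  set e : ℝ → Lp ℝ 2 measureT := fun s => R (T (R (uf s) - S s)) with he
  set e' : ℝ → Lp ℝ 2 measureT := fun s => R (T (R (uf' s) - S' s)) with he'
  set r : ℝ → Lp ℝ 2 measureT := fun s => R (A (uf s - R (uf s))) - R (T (uf' s - R (uf' s))) with hr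
  set Φ : ℝ → ℝ := fun s => sobolevNorm k (uf' s) ^ 2 + sobolevNorm k (uf s) ^ 2 +
              chebNorm (P.lumped (h s) (h' s) (f s)) ^ 2 with hΦ
  have hderiv : ∀ s, 0 ≤ s → HasDerivWithinAt e (e' s) (Ici 0) s := by
    intro s hs
    have h1 : HasDerivWithinAt (fun s => R (uf s)) (R (uf' s)) (Ici 0) s :=
      R.hasFDerivAt.comp_hasDerivWithinAt s (hu.deriv_uf s hs)
    have h2 := h1.sub (ha.hasDerivWithinAt hs)
    exact (R.comp T).hasFDerivAt.comp_hasDerivWithinAt s h2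
  have he0 : e 0 = 0 := by
    have : S 0 = R (uf 0) := by
      rw [hR, starProjection_eq_chebPoly (Filter.EventuallyEq.refl _ (uf 0))]
      simp only [hS, chebPoly]
      congr 1
      exact Finset.sum_congr rfl fun j hj => by
        rw [ha.init j (Nat.lt_succ_iff.1 (Finset.mem_range.1 hj))]
    simp [he, this]
  have hinner : ∀ s, 0 ≤ s → inner ℝ (e' s) (e s) ≤ inner ℝ (r s) (e s) := by
    intro s hs
    have h1 := ha.starProjection_eq hT hA hu hs
    have h2 : e' s = R (A (R (uf s) - S s)) + r s := by
      simp only [he', hr, map_sub] at h1 ⊢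
      rw [show R (T (S' s)) = _ from h1]
      abel
    rw [h2, inner_add_left]
    have h3 := hneg.inner_le_zero hT hA hn
      ((polySpace n).sub_mem ((polySpace n).starProjection_apply_mem (uf s)) (hSmem s))
    linarith [show inner ℝ (R (A (R (uf s) - S s))) (e s) ≤ 0 from h3]
  have hrbound : ∀ s, 0 ≤ s → ‖r s‖ ^ 2 ≤ (2 * M * b) ^ 2 * Φ s := by
    intro s hs
    set x := sobolevNorm k (uf s)
    set y := sobolevNorm k (uf' s)
    have hx : 0 ≤ x := sobolevNorm_nonneg _ _
    have hy : 0 ≤ y := sobolevNorm_nonneg _ _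
    have h1 : ‖r s‖ ≤ M * b * (x + y) := by
      calc ‖r s‖ ≤ ‖A‖ * (b * ((k : ℝ) ^ k * x)) + ‖T‖ * (b * ((k : ℝ) ^ k * y)) := by
            refine (norm_sub_le _ _).trans (add_le_add ?_ ?_)
            · refine (hRle _).trans ((A.le_opNorm _).trans ?_)
              gcongr
              exact happ0 _ (hmem s hs)
            · refine (hRle _).trans ((T.le_opNorm _).trans ?_)
              gcongr
              exact happ0 _ (hmem' s hs)
        _ ≤ (‖T‖ + ‖A‖) * (b * ((k : ℝ) ^ k * x)) + (‖T‖ + ‖A‖) * (b * ((k : ℝ) ^ k * y)) := by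
            gcongr
            · exact le_add_of_nonneg_left (norm_nonneg _)
            · exact le_add_of_nonneg_right (norm_nonneg _)
        _ = M * b * (x + y) := by rw [hM]; ring
    -- A generous factor `4` makes the bound a perfect square; the source term in `Φ` is just added,
    -- being nonnegative.
    have h2 : (x + y) ^ 2 ≤ 2 ^ 2 * Φ s := by
      have : Φ s = y ^ 2 + x ^ 2 + chebNorm (P.lumped (h s) (h' s) (f s)) ^ 2 := rfl
      nlinarith [sq_nonneg (x - y), sq_nonneg (chebNorm (P.lumped (h s) (h' s) (f s))),
        sq_nonneg x, sq_nonneg y]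
    calc ‖r s‖ ^ 2 ≤ (M * b * (x + y)) ^ 2 := by gcongr
      _ = (M * b) ^ 2 * (x + y) ^ 2 := by ring
      _ ≤ (M * b) ^ 2 * (2 ^ 2 * Φ s) := by gcongr
      _ = _ := by ring
  have hΦi : IntervalIntegrable Φ volume 0 t := by
    simp only [hΦ, sobolevNorm_sq]
    exact ((hi' t ht).add (hi t ht)).add (hig t ht)
  have hgron := norm_sq_le_exp_mul_integral ht hderiv he0 hinner hrbound (hΦi.const_mul _)
  rw [intervalIntegral.integral_const_mul] at hgron
  set J := ∫ s in (0 : ℝ)..t, Φ s with hJ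
  have hJ0 : 0 ≤ J := intervalIntegral.integral_nonneg ht fun s _ => by positivity
  have het : ‖e t‖ ≤ 2 * M * b * (Real.exp (t / 2) * √J) := by
    refine le_of_sq_le_sq ?_ (by positivity)
    refine hgron.trans (le_of_eq ?_)
    rw [mul_pow _ (Real.exp (t / 2) * √J), mul_pow (Real.exp (t / 2)), Real.sq_sqrt hJ0,
      ← Real.exp_nat_mul]
    rw [show ((2 : ℕ) : ℝ) * (t / 2) = t by push_cast; ring]
    ring
  have hsplit : T (uf t) - R (T (S t)) =
      (T (uf t) - R (T (uf t))) + R (T (uf t - R (uf t))) + e t := by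
    simp only [he, map_sub]; abel
  set x := sobolevNorm k (uf t) with hx
  have hx0 : 0 ≤ x := sobolevNorm_nonneg _ _
  set z := Real.exp (t / 2) * √J with hz
  have hz0 : 0 ≤ z := by positivity
  have h2 : ‖R (T (uf t - R (uf t)))‖ ≤ M * b * x := by
    refine (hRle _).trans ((T.le_opNorm _).trans ?_)
    calc ‖T‖ * ‖uf t - R (uf t)‖ ≤ ‖T‖ * (b * ((k : ℝ) ^ k * x)) := by
          gcongr; exact happ0 _ (hmem t ht)
      _ ≤ (‖T‖ + ‖A‖) * (b * ((k : ℝ) ^ k * x)) := by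
          gcongr; exact le_add_of_nonneg_right (norm_nonneg _)
      _ = M * b * x := by rw [hM]; ring
  change ‖T (uf t) - R (T (S t))‖ ≤ (C₁ + 2 * M) * b * (x + z)
  rw [hsplit]
  refine (norm_add₃_le).trans ?_
  have hMb : 0 ≤ M * b := mul_nonneg hM0 hb0
  have hCb : 0 ≤ C₁ * b := mul_nonneg hC₁ hb0
  nlinarith [mul_nonneg hMb hx0, mul_nonneg hCb hz0]

end ScalarPDE

/-! ### Order-zero norms and their integrability in time -/

theorem sobolevNorm_zero (v : ℝ → ℝ) : sobolevNorm 0 v = chebNorm v := by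
  simp [sobolevNorm, sobolevSq, chebNorm]

theorem sobolevSq_zero_eq (U : Lp ℝ 2 measureT) : sobolevSq 0 U = ‖U‖ ^ 2 := by
  rw [← sobolevNorm_sq, sobolevNorm_zero, chebNorm_eq_norm (Filter.EventuallyEq.refl _ _)]

theorem sobolevSq_zero_le (k : ℕ) (v : ℝ → ℝ) : sobolevSq 0 v ≤ sobolevSq k v := by
  rw [sobolevSq, sobolevSq, Finset.Icc_eq_empty (by norm_num), Finset.sum_empty]
  gcongr
  exact Finset.sum_nonneg fun _ _ =>
    intervalIntegral.integral_nonneg (by norm_num) fun _ _ => sq_nonneg _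

namespace ScalarPDE

variable {p : ℕ} {P : ScalarPDE p} {h h' : ℝ → Fin p → ℝ} {f : ℝ → ℝ → ℝ}
  {uf uf' : ℝ → Lp ℝ 2 measureT}

/-- Differentiability in time makes `u_f` continuous with values in `L²_w`. -/
theorem IsPIESolution.intervalIntegrable_norm_sq (hu : P.IsPIESolution h h' f uf uf') {t : ℝ}
    (ht : 0 ≤ t) : IntervalIntegrable (fun s => sobolevSq 0 (uf s)) volume 0 t := by
  simp only [sobolevSq_zero_eq]
  refine ContinuousOn.intervalIntegrable ?_
  rw [uIcc_of_le ht]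
  exact fun s hs => (((hu.deriv_uf s hs.1).continuousWithinAt.mono Icc_subset_Ici_self).norm).pow 2

/-- The order-`k` norm dominates. Measurability in time holds because `u̇_f` is the right derivative
of `u_f`, and right derivatives are strongly measurable. -/
theorem IsPIESolution.intervalIntegrable_norm_deriv_sq (hu : P.IsPIESolution h h' f uf uf') {k : ℕ}
    {t : ℝ} (ht : 0 ≤ t) (hi : IntervalIntegrable (fun s => sobolevSq k (uf' s)) volume 0 t) :
    IntervalIntegrable (fun s => sobolevSq 0 (uf' s)) volume 0 t := by
  refine hi.mono_fun ?_ (ae_of_all _ fun s => ?_)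
  · have hm : AEStronglyMeasurable (fun s => ‖derivWithin uf (Ici s) s‖ ^ 2)
        (volume.restrict (uIoc 0 t)) :=
      ((stronglyMeasurable_derivWithin_Ici uf).norm.pow 2).aestronglyMeasurable
    refine hm.congr ?_
    rw [uIoc_of_le ht]
    filter_upwards [ae_restrict_mem measurableSet_Ioc] with s hs
    have hd : HasDerivWithinAt uf (uf' s) (Ici s) s :=
      (hu.deriv_uf s hs.1.le).mono (Ici_subset_Ici.2 hs.1.le)
    rw [sobolevSq_zero_eq, hd.derivWithin (uniqueDiffOn_Ici s s self_mem_Ici)]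
  · simp only []
    rw [Real.norm_of_nonneg (sobolevSq_nonneg _ _), Real.norm_of_nonneg (sobolevSq_nonneg _ _)]
    exact sobolevSq_zero_le k _

end ScalarPDE

end PIE

theorem mainTheorem5 (p : ℕ) (hp : p ≤ 2) (P : PIE.ScalarPDE p) (hP : P.Admissible)
    (hneg : P.DiscreteNonpos) (m : ℕ) (hm : p ≤ m) :
    (∃ C : ℝ, ∀ (h h' : ℝ → Fin p → ℝ) (f : ℝ → ℝ → ℝ) (uf uf' : ℝ → Lp ℝ 2 measureT),
      P.IsPIESolution h h' f uf uf' → P.HasRegularity m h h' f uf uf' →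
      ∀ (N : ℕ) (a a' : ℝ → ℕ → ℝ), p < N →
        P.IsGalerkinSolution (N - p) h h' f (uf 0) a a' →
        ∀ t : ℝ, 0 ≤ t →
          P.primaryError (N - p) (h t) (uf t) (a t) ≤
            C * ((N : ℝ) - p) ^ ((p : ℤ) - (m : ℤ)) *
              (PIE.sobolevNorm (m - p) (uf t) +
                Real.exp (t / 2) *
                  √(∫ s in (0 : ℝ)..t, (PIE.sobolevNorm (m - p) (uf' s) ^ 2 +
                    PIE.sobolevNorm (m - p) (uf s) ^ 2 +
                    PIE.chebNorm (P.lumped (h s) (h' s) (f s)) ^ 2)))) ∧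
    (∀ (h h' : ℝ → Fin p → ℝ) (f : ℝ → ℝ → ℝ) (uf uf' : ℝ → Lp ℝ 2 measureT),
      P.IsPIESolution h h' f uf uf' → P.HasRegularity m h h' f uf uf' →
      ∀ t : ℝ, 0 ≤ t → ∃ C : ℝ, ∀ (N : ℕ) (a a' : ℝ → ℕ → ℝ), p < N →
        P.IsGalerkinSolution (N - p) h h' f (uf 0) a a' →
          P.primaryError (N - p) (h t) (uf t) (a t) ≤
            C * ((N : ℝ) - p) ^ ((p : ℤ) - (m : ℤ)) *
              (PIE.chebNorm (uf t) +
                Real.exp (t / 2) *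
                  √(∫ s in (0 : ℝ)..t, (PIE.chebNorm (uf' s) ^ 2 +
                    PIE.chebNorm (uf s) ^ 2 +
                    PIE.chebNorm (P.lumped (h s) (h' s) (f s)) ^ 2)))) := by
  have hpow : ∀ N : ℕ, p < N → ((N : ℝ) - p) ^ ((p : ℤ) - (m : ℤ)) =
      (((N - p : ℕ) : ℝ) ^ (m - p))⁻¹ := by
    intro N hN
    rw [Nat.cast_sub hN.le, ← zpow_natCast, ← zpow_neg, Nat.cast_sub hm, neg_sub]
  obtain ⟨C, hC⟩ : ∃ C : ℝ, ∀ (h h' : ℝ → Fin p → ℝ) (f : ℝ → ℝ → ℝ)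
      (uf uf' : ℝ → Lp ℝ 2 measureT),
      P.IsPIESolution h h' f uf uf' → P.HasRegularity m h h' f uf uf' →
      ∀ (N : ℕ) (a a' : ℝ → ℕ → ℝ), p < N →
        P.IsGalerkinSolution (N - p) h h' f (uf 0) a a' →
        ∀ t : ℝ, 0 ≤ t →
          P.primaryError (N - p) (h t) (uf t) (a t) ≤
            C * ((N : ℝ) - p) ^ ((p : ℤ) - (m : ℤ)) *
              (PIE.sobolevNorm (m - p) (uf t) +
                Real.exp (t / 2) *
                  √(∫ s in (0 : ℝ)..t, (PIE.sobolevNorm (m - p) (uf' s) ^ 2 +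
                    PIE.sobolevNorm (m - p) (uf s) ^ 2 +
                    PIE.chebNorm (P.lumped (h s) (h' s) (f s)) ^ 2))) := by
    obtain ⟨C, hC⟩ := PIE.ScalarPDE.exists_primaryError_le hp hP hneg (m - p)
    refine ⟨C, fun h h' f uf uf' hu hreg N a a' hN ha t ht => ?_⟩
    rw [hpow N hN]
    exact hC h h' f uf uf' hu
      (fun t ht => P.memH_of_primary hp hm (PIE.intervalIntegrable_coeFn _) (hreg.memH t ht))
      (fun t ht => P.memH_of_primary hp hm (PIE.intervalIntegrable_coeFn _) (hreg.memH_deriv t ht))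
      hreg.int_uf hreg.int_uf' hreg.int_g (N - p) a a' (by omega) ha t ht
  refine ⟨⟨C, hC⟩, fun h h' f uf uf' hu hreg t ht => ?_⟩
  -- The index `0` estimate has no rate, but its right-hand side is a multiple of the bracket `D`;
  -- it settles the case `D = 0`.
  obtain ⟨C₀, hC₀⟩ := PIE.ScalarPDE.exists_primaryError_le hp hP hneg 0
  simp only [PIE.sobolevNorm_zero, pow_zero, inv_one, mul_one] at hC₀
  have hL2 : ∀ U : Lp ℝ 2 measureT, PIE.MemH 0 U := fun U =>
    PIE.memLp_restrict_of_memLp_measureT (Lp.memLp U)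
  specialize hC₀ h h' f uf uf' hu (fun _ _ => hL2 _) (fun _ _ => hL2 _)
    (fun t ht => hu.intervalIntegrable_norm_sq ht)
    (fun t ht => hu.intervalIntegrable_norm_deriv_sq ht (hreg.int_uf' t ht)) hreg.int_g
  specialize hC h h' f uf uf' hu hreg
  set D := PIE.chebNorm (uf t) + Real.exp (t / 2) *
    √(∫ s in (0 : ℝ)..t, (PIE.chebNorm (uf' s) ^ 2 + PIE.chebNorm (uf s) ^ 2 +
      PIE.chebNorm (P.lumped (h s) (h' s) (f s)) ^ 2)) with hD
  set D' := PIE.sobolevNorm (m - p) (uf t) + Real.exp (t / 2) *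
    √(∫ s in (0 : ℝ)..t, (PIE.sobolevNorm (m - p) (uf' s) ^ 2 +
      PIE.sobolevNorm (m - p) (uf s) ^ 2 +
      PIE.chebNorm (P.lumped (h s) (h' s) (f s)) ^ 2)) with hD'
  rcases eq_or_ne D 0 with h0 | h0
  · refine ⟨0, fun N a a' hN ha => ?_⟩
    have := hC₀ (N - p) a a' (by omega) ha t ht
    rw [← hD, h0, mul_zero] at this
    simpa using this
  -- `D'` and `D` depend on the solution and on `t` but not on `N`, so their ratio may enter the
  -- constant.
  · refine ⟨C * D' / D, fun N a a' hN ha => ?_⟩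
    refine (hC N a a' hN ha t ht).trans (le_of_eq ?_)
    rw [← hD']
    field_simp
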